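/- **Definitions.** A finite linearly independent set of vectors $A=\{a^1,\dots,a^n\}\subset\mathbb R^d$ is identified with the $n\times d$ matrix whose rows are $a^1,\dots,a^n$. A matrix with $m$ rows is *equimodular* if it has full row rank and all its nonzero $m\times m$ determinants have the same absolute value, called its *equideterminant*; it is *totally equimodular* if every linearly independent set of its rows forms an equimodular matrix. It is *totally unimodular* if all its subdeterminants are $0$ or $\pm1$. A linearly independent set $A$ of vectors with entries in $\{0,1,-1\}$ is - a *te-set* if its matrix is totally equimodular, and a *tu-set* if its matrix is totally unimodular; - a *te-lace* if it is a te-set, not a tu-set, and all its nonempty subsets other than $A$ are tu-sets; - a *te-interlace* if it is a te-set, not a tu-set, and each pair of distinct vectors of $A$ is a te-lace; a te-interlace of size $n$ is *thin* if its equideterminant is $2^{n-1}$ and *thick* if it is $2^n$. A *te-brick* is a tu-set, a te-lace, a thin te-interlace or a thick te-interlace. Let $\operatorname{cone}(A)=\{\sum_j\lambda_j a^j:\lambda_j\ge 0\}$. The *Hilbert basis* $\mathcal H(C)$ of $C=\operatorname{cone}(A)$ is the finite set of nonzero integer vectors of $C$ which are not the sum of two nonzero integer vectors of $C$ and whose nonnegative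 integer combinations give all integer points of $C$. **Theorem 4.2.** Let $A=\{a^1,\dots,a^n\}\subset\mathbb R^d$ be a te-brick and $C=\operatorname{cone}(A)$. 1. If $A$ is a tu-set, then $\mathcal H(C)=A$. 2. If $A$ is a te-lace, then $\mathcal H(C)=A\cup\{\tfrac12\sum_j a^j\}$. 3. If $A$ is a thin te-interlace, then $\mathcal H(C)=A\cup\{\tfrac12(a^i+a^j):1\le i<j\le n\}$. 4. If $A$ is a thick te-interlace, then exactly one of the following holds: - (a) $\mathcal H(C)=A\cup\{\tfrac12(a^i+a^j):1\le i<j\le n\}\cup\{\tfrac14\sum_j a^j\}$; - (b) $\mathcal H(C)=A\cup\{\tfrac12(a^i+a^j):1\le i<j\le n\}\cup\{\tfrac34a^i+\tfrac14\sum_{j\ne i}a^j:1\le i\le n\}$. Moreover, there is $p\in\{0,1\}$ such that in every nonzero column of $A$ both the number of $1$'s and the number of $-1$'s are congruent to $p$ modulo $2$, and (a) occurs if and only if $n\equiv 2p\pmod 4$. -/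

import Mathlib

/-! A finite set of vectors is identified with the matrix whose rows are these vectors.  The rows
are indexed by a type `ι` and the coordinates by a type `κ`; since all the sets below are linearly
independent, the rows are pairwise distinct. -/

/-- All entries are `0`, `1` or `-1`. -/
def IsZeroPmOne {ι κ : Type*} (A : Matrix ι κ ℝ) : Prop :=
  ∀ i j, A i j = 0 ∨ A i j = 1 ∨ A i j = -1

/-- Equimodular: full row rank, and all nonzero determinants of maximal size have the same
absolute value.  (A column selection with a repetition gives the determinant zero, and reordering
the columns changes only the sign.) -/
def IsEquimodular {m : ℕ} {κ : Type*} (A : Matrix (Fin m) κ ℝ) : Prop :=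
  LinearIndependent ℝ A.row ∧
    ∀ f g : Fin m → κ, (A.submatrix id f).det ≠ 0 → (A.submatrix id g).det ≠ 0 →
      |(A.submatrix id f).det| = |(A.submatrix id g).det|

/-- `δ` is the equideterminant of the equimodular matrix `A`: the absolute value of its nonzero
determinants of maximal size. -/
def IsEquideterminant {m : ℕ} {κ : Type*} (A : Matrix (Fin m) κ ℝ) (δ : ℝ) : Prop :=
  IsEquimodular A ∧ ∃ f : Fin m → κ, (A.submatrix id f).det ≠ 0 ∧ |(A.submatrix id f).det| = δ

/-- Totally equimodular: every set of linearly independent rows forms an equimodular matrix. -/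
def IsTotallyEquimodular {ι κ : Type*} (A : Matrix ι κ ℝ) : Prop :=
  ∀ (k : ℕ) (r : Fin k → ι), r.Injective → LinearIndependent ℝ (A.submatrix r id).row →
    IsEquimodular (A.submatrix r id)

/-- A te-set. -/
def IsTeSet {ι κ : Type*} (A : Matrix ι κ ℝ) : Prop :=
  IsZeroPmOne A ∧ LinearIndependent ℝ A.row ∧ IsTotallyEquimodular A

/-- A tu-set. -/
def IsTuSet {ι κ : Type*} (A : Matrix ι κ ℝ) : Prop :=
  IsZeroPmOne A ∧ LinearIndependent ℝ A.row ∧ A.IsTotallyUnimodular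

/-- A te-lace: a te-set, not a tu-set, all of whose proper (nonempty) subsets are tu-sets. -/
def IsTeLace {ι κ : Type*} (A : Matrix ι κ ℝ) : Prop :=
  IsTeSet A ∧ ¬ IsTuSet A ∧
    ∀ S : Set ι, S.Nonempty → S ≠ Set.univ → IsTuSet (A.submatrix (Subtype.val : S → ι) id)

/-- A te-interlace: a te-set, not a tu-set, each pair of (distinct) vectors of which is a
te-lace. -/
def IsTeInterlace {ι κ : Type*} (A : Matrix ι κ ℝ) : Prop :=
  IsTeSet A ∧ ¬ IsTuSet A ∧ ∀ i j : ι, i ≠ j → IsTeLace (A.submatrix ![i, j] id)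

/-- A thin te-interlace.  (A te-interlace has at least two vectors, so `n - 1` is not
truncated.) -/
def IsThinTeInterlace {n : ℕ} {κ : Type*} (A : Matrix (Fin n) κ ℝ) : Prop :=
  IsTeInterlace A ∧ IsEquideterminant A (2 ^ (n - 1))

/-- A thick te-interlace. -/
def IsThickTeInterlace {n : ℕ} {κ : Type*} (A : Matrix (Fin n) κ ℝ) : Prop :=
  IsTeInterlace A ∧ IsEquideterminant A (2 ^ n)

/-- A te-brick. -/
def IsTeBrick {n : ℕ} {κ : Type*} (A : Matrix (Fin n) κ ℝ) : Prop :=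
  IsTuSet A ∨ IsTeLace A ∨ IsThinTeInterlace A ∨ IsThickTeInterlace A

/-- The cone generated by the rows of `A`. -/
def rowCone {ι κ : Type*} [Fintype ι] (A : Matrix ι κ ℝ) : Set (κ → ℝ) :=
  {x | ∃ c : ι → ℝ, (∀ i, 0 ≤ c i) ∧ x = ∑ i, c i • A.row i}

/-- The integer points of `C`. -/
def integerPoints {κ : Type*} (C : Set (κ → ℝ)) : Set (κ → ℝ) :=
  {x | x ∈ C ∧ ∀ j, ∃ z : ℤ, x j = z}

/-- A Hilbert basis element of `C`: a nonzero integer vector of `C` that is not the sum of two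
nonzero integer vectors of `C`. -/
def IsHilbertBasisElement {κ : Type*} (C : Set (κ → ℝ)) (h : κ → ℝ) : Prop :=
  h ∈ integerPoints C ∧ h ≠ 0 ∧
    ¬ ∃ x ∈ integerPoints C, ∃ y ∈ integerPoints C, x ≠ 0 ∧ y ≠ 0 ∧ h = x + y

/-- `H` is the Hilbert basis of `C`: a finite set of Hilbert basis elements whose nonnegative
integer combinations give all the integer points of `C`. -/
def IsHilbertBasis {κ : Type*} (C H : Set (κ → ℝ)) : Prop :=
  H.Finite ∧ (∀ h ∈ H, IsHilbertBasisElement C h) ∧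
    ∀ x ∈ integerPoints C, x ∈ AddSubmonoid.closure H

/-- The half-sums of two distinct rows. -/
def pairHalfSums {n : ℕ} {κ : Type*} (A : Matrix (Fin n) κ ℝ) : Set (κ → ℝ) :=
  {x | ∃ i j : Fin n, i < j ∧ x = (1 / 2 : ℝ) • (A.row i + A.row j)}

/-- The vectors `(3/4) a^i + (1/4) ∑_{j ≠ i} a^j`. -/
def threeQuarterSums {n : ℕ} {κ : Type*} (A : Matrix (Fin n) κ ℝ) : Set (κ → ℝ) :=
  {x | ∃ i : Fin n, x = (3 / 4 : ℝ) • A.row i +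
    (1 / 4 : ℝ) • ∑ j ∈ Finset.univ.erase i, A.row j}

/-! Everything is read off the lattice `coeffLattice A` of the coefficient vectors `c` for which
`∑ cᵢ aⁱ` is an integer vector.  Let `M` be a nonsingular submatrix formed by columns of `A`.  By
Cramer's rule equimodularity makes every column of `A` a combination with coefficients `0, ±1` of
the columns of `M`, so `c` is in the lattice as soon as `c M` is integer, and the rows of `M⁻¹`
generate the lattice (`HasEqualDets.mem_coeffLattice`).  Given the lattice, the Hilbert basis is
found by elementary means (`isHilbertBasis_image`): the listed vectors are indecomposable, and every
nonzero lattice vector with nonnegative entries dominates one of them.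

* For a tu-set the lattice is `ℤⁿ` (`IsTuSet.apply_mem_intReals`).
* For a te-lace it is `ℤⁿ ∪ (1/2 + ℤ)ⁿ` (`IsTeLace.forall_mem_or`, `IsTeLace.half_mem`).  For a
  column submatrix with determinant of absolute value `δ > 1`, the entries of the inverse are `0` or
  `±1/δ`, and a lattice vector with one integer entry is integer since the other rows are a tu-set.
  Thus all entries of the inverse are `±1/δ`, and a sum of two of its rows shows `δ = 2`.
* In a te-interlace the pairs are te-laces, so the lattice contains `ℤⁿ` and all `(eᵢ + eⱼ)/2`;
  these generate a lattice of determinant `2 ^ -(n - 1)`.  In the thin case this is everything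
  (`IsThinTeInterlace.two_mul_mem`).
* In the thick case the index is `2`.  The main point is that a lattice vector outside `(ℤ/2)ⁿ` has
  *all* its entries outside `ℤ/2` (`IsThickTeInterlace.forall_half_or`).  This uses the
  equimodularity of subsets of the rows: the nonzero entries in a column of `M⁻¹` have the same
  absolute value (`abs_inv_apply_eq`), and a parity argument then excludes a set of rows that
  carries such a vector and is not the whole of `A` (`IsTeSet.false_of_extension`).  Subtracting half sums
  leaves the vectors with at most one entry `3/4` and all others `1/4`, and counting signs in a
  column modulo `4` decides which of them are in the lattice. -/

open Matrix

/-! ### Coefficient lattices and Cramer's rule -/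

/-- The integers, as a subring of the reals. -/
abbrev intReals : Subring ℝ := (Int.castRingHom ℝ).range

lemma mem_intReals {x : ℝ} : x ∈ intReals ↔ ∃ z : ℤ, x = z := by
  simp [intReals, RingHom.mem_range, eq_comm]

lemma eq_zero_of_mem_intReals {x : ℝ} (hx : x ∈ intReals) (h : |x| < 1) : x = 0 := by
  obtain ⟨z, rfl⟩ := mem_intReals.1 hx
  have : |z| < 1 := by exact_mod_cast h
  simp [Int.abs_lt_one_iff.1 this]

lemma det_mem_subring {ι : Type*} [Fintype ι] [DecidableEq ι] (R : Subring ℝ)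
    (M : Matrix ι ι ℝ) (h : ∀ i j, M i j ∈ R) : M.det ∈ R := by
  rw [det_apply']
  exact R.sum_mem fun σ _ => R.mul_mem (intCast_mem R _) (R.prod_mem fun i _ => h _ _)

lemma adjugate_mem_subring {ι : Type*} [Fintype ι] [DecidableEq ι] (R : Subring ℝ)
    (M : Matrix ι ι ℝ) (h : ∀ i j, M i j ∈ R) (i j : ι) : M.adjugate i j ∈ R := by
  rw [adjugate_apply]
  refine det_mem_subring R _ fun a b => ?_
  by_cases ha : a = j
  · subst ha
    rw [updateRow_self]
    by_cases hb : b = i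
    · subst hb; simp
    · simp [Pi.single_eq_of_ne hb]
  · rw [updateRow_ne ha]; exact h _ _

/-- The coefficient vectors `c` for which the combination `c ᵥ* A` of the rows of `A` is an integer
vector. -/
def coeffLattice {ι κ : Type*} [Fintype ι] (A : Matrix ι κ ℝ) : AddSubgroup (ι → ℝ) where
  carrier := {c | ∀ j, (c ᵥ* A) j ∈ intReals}
  zero_mem' j := by simp
  add_mem' ha hb j := by rw [add_vecMul]; exact intReals.add_mem (ha j) (hb j)
  neg_mem' ha j := by rw [neg_vecMul]; exact intReals.neg_mem (ha j)

lemma mem_coeffLattice {ι κ : Type*} [Fintype ι] {A : Matrix ι κ ℝ} {c : ι → ℝ} :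
    c ∈ coeffLattice A ↔ ∀ j, (c ᵥ* A) j ∈ intReals := Iff.rfl

lemma smul_mem_coeffLattice {ι κ : Type*} [Fintype ι] {A : Matrix ι κ ℝ} {c : ι → ℝ} {t : ℝ}
    (ht : t ∈ intReals) (hc : c ∈ coeffLattice A) : t • c ∈ coeffLattice A := fun j => by
  rw [smul_vecMul]; exact intReals.mul_mem ht (hc j)

lemma IsZeroPmOne.mem_intReals {ι κ : Type*} {A : Matrix ι κ ℝ} (h : IsZeroPmOne A) (i : ι)
    (j : κ) : A i j ∈ intReals := by
  rcases h i j with h | h | h <;> rw [h]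
  exacts [intReals.zero_mem, intReals.one_mem, intReals.neg_mem intReals.one_mem]

lemma mem_coeffLattice_of_forall_mem {ι κ : Type*} [Fintype ι] {A : Matrix ι κ ℝ}
    (hA : IsZeroPmOne A) {c : ι → ℝ} (hc : ∀ i, c i ∈ intReals) : c ∈ coeffLattice A := fun j =>
  intReals.sum_mem fun i _ => intReals.mul_mem (hc i) (hA.mem_intReals i j)

lemma exists_submatrix_det_ne_zero {ι κ : Type*} [Fintype ι] [DecidableEq ι] [Fintype κ]
    {A : Matrix ι κ ℝ} (h : LinearIndependent ℝ A.row) :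
    ∃ f : ι → κ, (A.submatrix id f).det ≠ 0 := by
  obtain ⟨κ', a, -, hspan, hli⟩ := exists_linearIndependent' ℝ A.col
  have hfin : Finite κ' := hli.finite
  have := Fintype.ofFinite κ'
  have hcard : Fintype.card ι = Fintype.card κ' := by
    rw [← h.rank_matrix, rank_eq_finrank_span_cols, ← hspan, finrank_span_eq_card hli]
  let e : ι ≃ κ' := Fintype.equivOfCardEq hcard
  refine ⟨a ∘ e, ?_⟩
  have h2 : LinearIndependent ℝ (A.submatrix id (a ∘ e)).col := hli.comp e e.injective
  exact ((isUnit_iff_isUnit_det _).1 (linearIndependent_cols_iff_isUnit.1 h2)).ne_zero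

section Square

variable {ι : Type*} [Fintype ι] [DecidableEq ι] {M : Matrix ι ι ℝ}

lemma inv_row_vecMul (h : M.det ≠ 0) (j : ι) : M⁻¹ j ᵥ* M = Pi.single j 1 := by
  have h1 : M⁻¹ * M = 1 := nonsing_inv_mul _ (isUnit_iff_ne_zero.2 h)
  have := congrFun h1 j
  rw [mul_apply_eq_vecMul] at this
  rw [this]; ext k; simp [one_apply, Pi.single_apply, eq_comm]

lemma eq_sum_inv_rows (h : M.det ≠ 0) (c : ι → ℝ) : c = ∑ j, (c ᵥ* M) j • M⁻¹ j := by
  rw [← vecMul_eq_sum, vecMul_vecMul, mul_nonsing_inv _ (isUnit_iff_ne_zero.2 h), vecMul_one]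

lemma vecMul_injective_of_det_ne_zero (h : M.det ≠ 0) {c c' : ι → ℝ} (hc : c ᵥ* M = c' ᵥ* M) :
    c = c' := by
  rw [eq_sum_inv_rows h c, eq_sum_inv_rows h c', hc]

lemma inv_row_ne_zero (h : M.det ≠ 0) (j : ι) : M⁻¹ j ≠ 0 := fun h0 => by
  have := congrFun (inv_row_vecMul h j) j
  simp [h0] at this

lemma inv_apply_eq_adjugate_div (i j : ι) : M⁻¹ i j = M.adjugate i j / M.det := by
  rw [inv_def, Matrix.smul_apply, Ring.inverse_eq_inv', smul_eq_mul, div_eq_inv_mul]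

end Square

/-- All nonzero determinants of maximal size have the same absolute value. -/
def HasEqualDets {ι κ : Type*} [Fintype ι] [DecidableEq ι] (A : Matrix ι κ ℝ) : Prop :=
  ∀ f g : ι → κ, (A.submatrix id f).det ≠ 0 → (A.submatrix id g).det ≠ 0 →
      |(A.submatrix id f).det| = |(A.submatrix id g).det|

section EqualDets

variable {ι κ : Type*} [Fintype ι] [DecidableEq ι] {A : Matrix ι κ ℝ}

/-- By Cramer's rule, every column of `A` has coordinates `0, ±1` in a basis of columns. -/
lemma HasEqualDets.inv_mulVec (hA : HasEqualDets A) {f : ι → κ}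
    (hf : (A.submatrix id f).det ≠ 0) (k : κ) (j : ι) :
    ((A.submatrix id f)⁻¹ *ᵥ fun i => A i k) j = 0 ∨
      ((A.submatrix id f)⁻¹ *ᵥ fun i => A i k) j = 1 ∨
      ((A.submatrix id f)⁻¹ *ᵥ fun i => A i k) j = -1 := by
  set M := A.submatrix id f with hM
  have h1 : (M⁻¹ *ᵥ fun i => A i k) j = (A.submatrix id (Function.update f j k)).det / M.det := by
    have h2 : M.updateCol j (fun i => A i k) = A.submatrix id (Function.update f j k) := by
      ext a b
      by_cases hb : b = j
      · subst hb; simp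
      · simp [hb, hM]
    rw [← h2, ← cramer_apply, cramer_eq_adjugate_mulVec, inv_def, smul_mulVec, Pi.smul_apply,
      Ring.inverse_eq_inv', smul_eq_mul, div_eq_inv_mul]
  rw [h1]
  by_cases h0 : (A.submatrix id (Function.update f j k)).det = 0
  · left; rw [h0, zero_div]
  · right
    rcases abs_eq_abs.1 (hA _ f h0 hf) with h | h <;> rw [h]
    · left; exact div_self hf
    · right; rw [neg_div, div_self hf]

lemma HasEqualDets.mem_coeffLattice (hA : HasEqualDets A) {f : ι → κ}
    (hf : (A.submatrix id f).det ≠ 0) {c : ι → ℝ}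
    (hc : ∀ j, (c ᵥ* A.submatrix id f) j ∈ intReals) : c ∈ coeffLattice A := fun k => by
  have h1 : (c ᵥ* A) k =
      (c ᵥ* A.submatrix id f) ⬝ᵥ ((A.submatrix id f)⁻¹ *ᵥ fun i => A i k) := by
    rw [dotProduct_mulVec, vecMul_vecMul, mul_nonsing_inv _ (isUnit_iff_ne_zero.2 hf), vecMul_one]
    rfl
  rw [h1]
  refine intReals.sum_mem fun j _ => intReals.mul_mem (hc j) ?_
  rcases hA.inv_mulVec hf k j with h | h | h <;> rw [h]
  exacts [intReals.zero_mem, intReals.one_mem, intReals.neg_mem intReals.one_mem]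

lemma HasEqualDets.inv_row_mem (hA : HasEqualDets A) {f : ι → κ}
    (hf : (A.submatrix id f).det ≠ 0) (j : ι) :
    (A.submatrix id f)⁻¹ j ∈ coeffLattice A :=
  hA.mem_coeffLattice hf fun k => by
    rw [inv_row_vecMul hf, Pi.single_apply]
    split_ifs
    exacts [intReals.one_mem, intReals.zero_mem]

end EqualDets

lemma IsTeSet.hasEqualDets {ι κ : Type*} {A : Matrix ι κ ℝ} (hA : IsTeSet A) {m : ℕ}
    {r : Fin m → ι} (hr : r.Injective) : HasEqualDets (A.submatrix r id) :=
  (hA.2.2 m r hr (hA.2.1.comp r hr)).2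

lemma IsTeSet.hasEqualDets_self {m : ℕ} {κ : Type*} {A : Matrix (Fin m) κ ℝ} (hA : IsTeSet A) :
    HasEqualDets A := hA.hasEqualDets (r := id) Function.injective_id

/-- The nonzero entries in a column of the inverse of a nonsingular column submatrix are, up to
sign and a common factor, the nonzero maximal determinants of the matrix without the corresponding
row. -/
lemma abs_inv_apply_eq {m : ℕ} {κ : Type*} {A : Matrix (Fin (m + 1)) κ ℝ}
    {l : Fin (m + 1)} (hA : HasEqualDets (A.submatrix l.succAbove id)) {f : Fin (m + 1) → κ}
    {i j : Fin (m + 1)}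
    (hi : (A.submatrix id f)⁻¹ i l ≠ 0) (hj : (A.submatrix id f)⁻¹ j l ≠ 0) :
    |(A.submatrix id f)⁻¹ i l| = |(A.submatrix id f)⁻¹ j l| := by
  have key : ∀ i, (A.submatrix id f)⁻¹ i l = (-1) ^ (l + i : ℕ) *
      ((A.submatrix l.succAbove id).submatrix id (f ∘ i.succAbove)).det /
        (A.submatrix id f).det := fun i => by
    rw [inv_apply_eq_adjugate_div, adjugate_fin_succ_eq_det_submatrix]; rfl
  rw [key] at hi hj
  rw [key, key, abs_div, abs_div, abs_mul, abs_mul, abs_neg_one_pow, abs_neg_one_pow]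
  rw [hA (f ∘ i.succAbove) (f ∘ j.succAbove)]
  · intro h; rw [h] at hi; simp at hi
  · intro h; rw [h] at hj; simp at hj

/-! ### Lattices of tu-sets and te-laces -/

/-- The coefficients of the integer points spanned by a tu-set are integers. -/
lemma IsTuSet.apply_mem_intReals {ι κ : Type*} [Fintype ι] [DecidableEq ι] [Fintype κ]
    {A : Matrix ι κ ℝ} (hA : IsTuSet A) {c : ι → ℝ} (hc : c ∈ coeffLattice A) (i : ι) :
    c i ∈ intReals := by
  obtain ⟨f, hf⟩ := exists_submatrix_det_ne_zero hA.2.1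
  rw [eq_sum_inv_rows hf c, Finset.sum_apply]
  refine intReals.sum_mem fun j _ => intReals.mul_mem (hc (f j)) ?_
  rw [inv_apply_eq_adjugate_div]
  have hadj : (A.submatrix id f).adjugate j i ∈ intReals :=
    adjugate_mem_subring _ _ (fun a b => hA.1.mem_intReals _ _) _ _
  obtain ⟨s, hs⟩ := (isTotallyUnimodular_iff_fintype A).1 hA.2.2 ι id f
  rcases s with _ | _ | _
  · exact absurd (by rw [← hs]; rfl) hf
  · rw [← hs]
    have : ((SignType.neg : SignType) : ℝ) = -1 := by simp
    rw [this, div_neg, div_one]; exact intReals.neg_mem hadj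
  · rw [← hs]
    have : ((SignType.pos : SignType) : ℝ) = 1 := by simp
    rw [this, div_one]; exact hadj

/-- An integer point whose coefficient in one row is an integer is, after subtraction of a
multiple of that row, spanned by the other rows. -/
lemma IsTeLace.apply_mem_intReals {n : ℕ} {κ : Type*} [Fintype κ]
    {A : Matrix (Fin n) κ ℝ} (hA : IsTeLace A) {c : Fin n → ℝ} (hc : c ∈ coeffLattice A)
    {i : Fin n} (hi : c i ∈ intReals) (j : Fin n) : c j ∈ intReals := by
  by_cases hj : j = i
  · exact hj ▸ hi
  classical
  have hS := hA.2.2 {i}ᶜ ⟨j, hj⟩ (by simp)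
  refine hS.apply_mem_intReals (c := fun k => c k) ?_ ⟨j, hj⟩
  intro k
  have h1 : ((fun k : ({i}ᶜ : Set (Fin n)) => c k) ᵥ* A.submatrix Subtype.val id) k =
      (c ᵥ* A) k - c i * A i k := by
    have h2 : (c ᵥ* A) k = ∑ l, c l * A l k := rfl
    rw [h2, ← Finset.add_sum_erase _ _ (Finset.mem_univ i), add_sub_cancel_left]
    change ∑ l : ({i}ᶜ : Set (Fin n)), c l * A l k = _
    symm
    exact Finset.sum_subtype _ (by simp) (fun l => c l * A l k)
  rw [h1]
  exact intReals.sub_mem (hc k) (intReals.mul_mem hi (hA.1.1.mem_intReals _ _))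

lemma signType_cast_mem (s : SignType) : (s : ℝ) = 0 ∨ (s : ℝ) = 1 ∨ (s : ℝ) = -1 := by
  rcases s with _ | _ | _
  · left; rfl
  · right; right; simp
  · right; left; simp

lemma mem_range_signType_cast {x : ℝ} (h : x = 0 ∨ x = 1 ∨ x = -1) :
    x ∈ Set.range (SignType.cast : SignType → ℝ) := by
  rcases h with rfl | rfl | rfl
  exacts [⟨0, by simp⟩, ⟨1, by simp⟩, ⟨-1, by simp⟩]

/-- A te-lace has a nonsingular column submatrix of determinant other than `±1`: every smaller
determinant lives on a proper subset of the rows. -/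
lemma IsTeLace.exists_one_lt_abs_det {n : ℕ} {κ : Type*} [Fintype κ]
    {A : Matrix (Fin n) κ ℝ} (hA : IsTeLace A) :
    ∃ f : Fin n → κ, 1 < |(A.submatrix id f).det| := by
  classical
  by_contra hcon
  push Not at hcon
  have hint : ∀ f : Fin n → κ, (A.submatrix id f).det = 0 ∨ (A.submatrix id f).det = 1 ∨
      (A.submatrix id f).det = -1 := by
    intro f
    obtain ⟨z, hz⟩ := mem_intReals.1 (det_mem_subring intReals (A.submatrix id f)
      fun a b => hA.1.1.mem_intReals _ _)
    have h1 := hcon f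
    rw [hz] at h1 ⊢
    have h2 : |z| ≤ 1 := by exact_mod_cast h1
    have h3 := abs_le.1 h2
    have : z = 0 ∨ z = 1 ∨ z = -1 := by omega
    rcases this with rfl | rfl | rfl <;> simp
  refine hA.2.1 ⟨hA.1.1, hA.1.2.1, ?_⟩
  intro k f g hf hg
  by_cases hsurj : Function.Surjective f
  · have hkn : k = n := by
      simpa using Fintype.card_of_bijective ⟨hf, hsurj⟩
    subst hkn
    let e := Equiv.ofBijective f ⟨hf, hsurj⟩
    have h1 : A.submatrix f g = (A.submatrix id (g ∘ e.symm)).submatrix e e := by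
      ext a b; simp [e]; rfl
    rw [h1, det_submatrix_equiv_self]
    exact mem_range_signType_cast (hint _)
  · rcases k.eq_zero_or_pos with rfl | hk
    · rw [det_fin_zero]; exact ⟨1, by simp⟩
    · have hS := hA.2.2 (Set.range f) ⟨f ⟨0, hk⟩, Set.mem_range_self _⟩
        (fun h => hsurj (Set.range_eq_univ.1 h))
      exact hS.2.2 k (fun i => ⟨f i, Set.mem_range_self i⟩) g
        (fun a b hab => hf (by simpa using hab)) hg

/-- The inverse of a nonsingular column submatrix whose determinant is not `±1` has all entries
`±1/2`.  Its entries are `0` or `±1/δ`, where `δ` is the absolute value of the determinant, and a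
row with an integer entry is integer; so all are `±1/δ`, and adding two rows gives `δ = 2`. -/
lemma IsTeLace.exists_abs_inv_apply_eq_half {n : ℕ} {κ : Type*} [Fintype κ]
    {A : Matrix (Fin n) κ ℝ} (hA : IsTeLace A) :
    ∃ f : Fin n → κ, (A.submatrix id f).det ≠ 0 ∧
      ∀ i j, |(A.submatrix id f)⁻¹ i j| = 1 / 2 := by
  classical
  obtain ⟨f, hf1⟩ := hA.exists_one_lt_abs_det
  have hf : (A.submatrix id f).det ≠ 0 := by
    intro h; rw [h] at hf1; norm_num at hf1
  refine ⟨f, hf, ?_⟩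
  rcases n with _ | m
  · exact fun i => i.elim0
  set M := A.submatrix id f with hM
  have hL : ∀ i, M⁻¹ i ∈ coeffLattice A := hA.1.hasEqualDets_self.inv_row_mem hf
  have hentry : ∀ i j, M⁻¹ i j = 0 ∨ |M⁻¹ i j| = 1 / |M.det| := by
    intro i j
    have hadj : M.adjugate i j = 0 ∨ |M.adjugate i j| = 1 := by
      rw [adjugate_fin_succ_eq_det_submatrix, abs_mul, abs_neg_one_pow, one_mul]
      have : (M.submatrix j.succAbove i.succAbove).det = 0 ∨
          (M.submatrix j.succAbove i.succAbove).det = 1 ∨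
          (M.submatrix j.succAbove i.succAbove).det = -1 := by
        rcases m.eq_zero_or_pos with rfl | hm
        · right; left; exact det_fin_zero
        · have hS := hA.2.2 {j}ᶜ ⟨j.succAbove ⟨0, hm⟩, Fin.succAbove_ne _ _⟩ (by simp)
          obtain ⟨s, hs⟩ := (isTotallyUnimodular_iff _).1 hS.2.2 m
            (fun a => ⟨j.succAbove a, Fin.succAbove_ne _ _⟩) (f ∘ i.succAbove)
          have h2 : M.submatrix j.succAbove i.succAbove =
            (A.submatrix (Subtype.val : ({j}ᶜ : Set (Fin (m + 1))) → _) id).submatrix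
              (fun a => ⟨j.succAbove a, Fin.succAbove_ne _ _⟩) (f ∘ i.succAbove) := rfl
          rw [h2, ← hs]
          exact signType_cast_mem s
      rcases this with h | h | h <;> simp [h]
    rw [inv_apply_eq_adjugate_div, abs_div]
    rcases hadj with h | h
    · left; rw [h, zero_div]
    · right; rw [h]
  have hlt : 1 / |M.det| < 1 := by rw [div_lt_one (by linarith)]; exact hf1
  have hpos : 0 < 1 / |M.det| := by positivity
  have hne : ∀ i j, M⁻¹ i j ≠ 0 := by
    intro i j h0
    refine inv_row_ne_zero hf i (funext fun k => ?_)
    refine eq_zero_of_mem_intReals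
      (hA.apply_mem_intReals (hL i) (i := j) (by rw [h0]; exact intReals.zero_mem) k) ?_
    rcases hentry i k with h | h
    · rw [h]; norm_num
    · rw [h]; exact hlt
  have habs : ∀ i j, |M⁻¹ i j| = 1 / |M.det| := fun i j => (hentry i j).resolve_left (hne i j)
  -- A matrix with one row and entries `0, ±1` has no determinant larger than `1`.
  have hm : m ≠ 0 := by
    rintro rfl
    rw [det_fin_one] at hf1
    rcases hA.1.1 0 (f 0) with h | h | h <;> simp [hM, h] at hf1
    norm_num at hf1
  have h01 : (0 : Fin (m + 1)) ≠ Fin.last m := by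
    intro h; exact hm (by simpa [Fin.ext_iff] using h.symm)
  -- The first and the last row of the inverse are neither equal nor opposite.
  have hdiff : ∀ t : ℝ, M⁻¹ 0 + t • M⁻¹ (Fin.last m) ≠ 0 := by
    intro t h
    have h1 : (M⁻¹ 0 + t • M⁻¹ (Fin.last m)) ᵥ* M = 0 := by rw [h, zero_vecMul]
    rw [add_vecMul, smul_vecMul, inv_row_vecMul hf, inv_row_vecMul hf] at h1
    have := congrFun h1 0
    simp [h01] at this
  have hpm : ∀ j, M⁻¹ 0 j = M⁻¹ (Fin.last m) j ∨ M⁻¹ 0 j = -M⁻¹ (Fin.last m) j := fun j =>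
    abs_eq_abs.1 ((habs _ _).trans (habs _ _).symm)
  obtain ⟨j₀, hj₀⟩ : ∃ j, M⁻¹ 0 j + M⁻¹ (Fin.last m) j = 0 := by
    by_contra hno
    push Not at hno
    refine hdiff (-1) (funext fun j => ?_)
    rcases hpm j with h | h
    · simp [h]
    · exact absurd (by rw [h]; ring) (hno j)
  obtain ⟨j₁, hj₁⟩ : ∃ j, M⁻¹ 0 j + M⁻¹ (Fin.last m) j ≠ 0 := by
    by_contra hno
    push Not at hno
    exact hdiff 1 (funext fun j => by simpa using hno j)
  have hint : M⁻¹ 0 j₁ + M⁻¹ (Fin.last m) j₁ ∈ intReals :=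
    hA.apply_mem_intReals (c := M⁻¹ 0 + M⁻¹ (Fin.last m)) (add_mem (hL _) (hL _)) (i := j₀)
      (by rw [Pi.add_apply, hj₀]; exact intReals.zero_mem) j₁
  have h2 : |M⁻¹ 0 j₁ + M⁻¹ (Fin.last m) j₁| = 2 / |M.det| := by
    rcases hpm j₁ with h | h
    · rw [h, ← two_mul, abs_mul, habs]; norm_num; ring
    · exact absurd (by rw [h]; ring) hj₁
  obtain ⟨d, hd⟩ := mem_intReals.1 (det_mem_subring intReals M
    fun a b => hA.1.1.mem_intReals a (f b))
  have hδ : |M.det| = 2 := by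
    by_contra hne2
    have h3 : (2 : ℝ) < |M.det| := by
      refine lt_of_le_of_ne ?_ (Ne.symm hne2)
      rw [hd] at hf1 ⊢
      have : 1 < |d| := by exact_mod_cast hf1
      have : 2 ≤ |d| := this
      exact_mod_cast this
    refine hj₁ (eq_zero_of_mem_intReals hint ?_)
    rw [h2, div_lt_one (by linarith)]; exact h3
  intro i j
  rw [habs, hδ]

lemma mem_intReals_or_of_two_mul {x : ℝ} (h : 2 * x ∈ intReals) :
    x ∈ intReals ∨ x - 1 / 2 ∈ intReals := by
  obtain ⟨z, hz⟩ := mem_intReals.1 h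
  rcases Int.even_or_odd' z with ⟨w, rfl | rfl⟩
  · left; exact mem_intReals.2 ⟨w, by push_cast at hz; linarith⟩
  · right; exact mem_intReals.2 ⟨w, by push_cast at hz; linarith⟩

/-- The coefficients of the integer points spanned by a te-lace are all integers or all halves of
odd integers. -/
lemma IsTeLace.forall_mem_or {n : ℕ} {κ : Type*} [Fintype κ]
    {A : Matrix (Fin n) κ ℝ} (hA : IsTeLace A) {c : Fin n → ℝ} (hc : c ∈ coeffLattice A) :
    (∀ i, c i ∈ intReals) ∨ ∀ i, c i - 1 / 2 ∈ intReals := by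
  obtain ⟨f, hf, hhalf⟩ := hA.exists_abs_inv_apply_eq_half
  have h2 : ∀ i, 2 * c i ∈ intReals := by
    intro i
    rw [eq_sum_inv_rows hf c, Finset.sum_apply, Finset.mul_sum]
    refine intReals.sum_mem fun j _ => ?_
    rw [Pi.smul_apply, smul_eq_mul, mul_left_comm]
    refine intReals.mul_mem (hc (f j)) ?_
    rcases (abs_eq (by norm_num)).1 (hhalf j i) with h | h <;> rw [h]
    · exact mem_intReals.2 ⟨1, by norm_num⟩
    · exact mem_intReals.2 ⟨-1, by norm_num⟩
  by_cases hex : ∃ i, c i ∈ intReals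
  · obtain ⟨i, hi⟩ := hex
    exact Or.inl (hA.apply_mem_intReals hc hi)
  · push Not at hex
    exact Or.inr fun i => (mem_intReals_or_of_two_mul (h2 i)).resolve_left (hex i)

lemma IsTeLace.pos {n : ℕ} {κ : Type*} [Fintype κ] {A : Matrix (Fin n) κ ℝ}
    (hA : IsTeLace A) : 0 < n := by
  rcases n.eq_zero_or_pos with rfl | h
  · obtain ⟨f, hf⟩ := hA.exists_one_lt_abs_det
    simp at hf
  · exact h

lemma IsTeLace.half_mem {n : ℕ} {κ : Type*} [Fintype κ]
    {A : Matrix (Fin n) κ ℝ} (hA : IsTeLace A) : (fun _ => 1 / 2) ∈ coeffLattice A := by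
  classical
  obtain ⟨f, hf, hhalf⟩ := hA.exists_abs_inv_apply_eq_half
  let i : Fin n := ⟨0, hA.pos⟩
  have h1 := hA.1.hasEqualDets_self.inv_row_mem hf i
  have h2 : (fun _ => 1 / 2 : Fin n → ℝ) =
      (A.submatrix id f)⁻¹ i + fun j => 1 / 2 - (A.submatrix id f)⁻¹ i j := by
    ext j; simp
  rw [h2]
  refine add_mem h1 (mem_coeffLattice_of_forall_mem hA.1.1 fun j => ?_)
  rcases (abs_eq (by norm_num)).1 (hhalf i j) with h | h <;> rw [h]
  · exact mem_intReals.2 ⟨0, by norm_num⟩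
  · exact mem_intReals.2 ⟨1, by norm_num⟩

/-! ### Hilbert bases from coefficient vectors, and lattices of te-interlaces -/

section Hilbert

variable {ι κ : Type*} [Fintype ι] {A : Matrix ι κ ℝ}

lemma mem_integerPoints_rowCone {x : κ → ℝ} :
    x ∈ integerPoints (rowCone A) ↔ ∃ c ∈ coeffLattice A, 0 ≤ c ∧ x = c ᵥ* A := by
  constructor
  · rintro ⟨⟨c, hc, hx⟩, hint⟩
    have hx' : x = c ᵥ* A := by rw [hx, vecMul_eq_sum]; rfl
    exact ⟨c, fun j => mem_intReals.2 (by rw [← hx']; exact hint j), hc, hx'⟩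
  · rintro ⟨c, hcL, hc, rfl⟩
    refine ⟨⟨c, hc, ?_⟩, fun j => mem_intReals.1 (hcL j)⟩
    rw [vecMul_eq_sum]; rfl

/-- Recognition of a Hilbert basis through coefficient vectors: the elements of `X` are
indecomposable, and every nonzero coefficient vector dominates one of them, so that subtracting
elements of `X` terminates. -/
lemma isHilbertBasis_image (hA : LinearIndependent ℝ A.row) {X : Set (ι → ℝ)} (hfin : X.Finite)
    (hL : ∀ x ∈ X, x ∈ coeffLattice A) (hX0 : ∀ x ∈ X, 0 ≤ x) (hpos : ∀ x ∈ X, ∃ i, 1 / 4 ≤ x i)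
    (hirr : ∀ x ∈ X, ∀ y ∈ coeffLattice A, 0 ≤ y → y ≤ x → y = 0 ∨ y = x)
    (hgen : ∀ c ∈ coeffLattice A, 0 ≤ c → c ≠ 0 → ∃ x ∈ X, x ≤ c) :
    IsHilbertBasis (rowCone A) ((fun c => c ᵥ* A) '' X) := by
  have hinj : Function.Injective fun c : ι → ℝ => c ᵥ* A := vecMul_injective_iff.2 hA
  refine ⟨hfin.image _, ?_, ?_⟩
  · rintro _ ⟨x, hx, rfl⟩
    refine ⟨mem_integerPoints_rowCone.2 ⟨x, hL x hx, hX0 x hx, rfl⟩, ?_, ?_⟩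
    · intro h0
      have hx0 : x = 0 := hinj (by simpa using h0)
      obtain ⟨i, hi⟩ := hpos x hx
      rw [hx0, Pi.zero_apply] at hi
      norm_num at hi
    · rintro ⟨_, hy, _, hz, hy0, hz0, hsum⟩
      obtain ⟨y, hyL, hy', rfl⟩ := mem_integerPoints_rowCone.1 hy
      obtain ⟨z, hzL, hz', rfl⟩ := mem_integerPoints_rowCone.1 hz
      have hxyz : x = y + z := hinj (by simpa [add_vecMul] using hsum)
      rcases hirr x hx y hyL hy' (by rw [hxyz]; exact le_add_of_nonneg_right hz') with h | h
      · exact hy0 (by rw [h, zero_vecMul])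
      · refine hz0 ?_
        have : z = 0 := by rw [hxyz] at h; simpa using h
        rw [this, zero_vecMul]
  · have key : ∀ N : ℕ, ∀ c ∈ coeffLattice A, 0 ≤ c → ∑ i, c i < N / 4 →
        c ᵥ* A ∈ AddSubmonoid.closure ((fun c => c ᵥ* A) '' X) := by
      intro N
      induction N with
      | zero =>
        intro c _ hc hlt
        have : 0 ≤ ∑ i, c i := Finset.sum_nonneg fun i _ => hc i
        norm_num at hlt
        linarith
      | succ N ih =>
        intro c hcL hc hlt
        by_cases h0 : c = 0
        · rw [h0, zero_vecMul]; exact zero_mem _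
        obtain ⟨x, hx, hxc⟩ := hgen c hcL hc h0
        have h1 : c ᵥ* A = x ᵥ* A + (c - x) ᵥ* A := by rw [← add_vecMul]; simp
        rw [h1]
        refine add_mem (AddSubmonoid.subset_closure ⟨x, hx, rfl⟩)
          (ih _ (sub_mem hcL (hL x hx)) (sub_nonneg.2 hxc) ?_)
        obtain ⟨i, hi⟩ := hpos x hx
        have h2 : x i ≤ ∑ i, x i :=
          Finset.single_le_sum (fun j _ => hX0 x hx j) (Finset.mem_univ i)
        simp only [Pi.sub_apply, Finset.sum_sub_distrib]
        push_cast at hlt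
        linarith
    intro v hv
    obtain ⟨c, hcL, hc, rfl⟩ := mem_integerPoints_rowCone.1 hv
    obtain ⟨N, hN⟩ := exists_nat_gt (4 * ∑ i, c i)
    exact key N c hcL hc (by linarith)

end Hilbert

/-- Coefficient vectors supported on the rows `r` correspond to those of the submatrix. -/
lemma comp_mem_coeffLattice_iff {ι ι' κ : Type*} [Fintype ι] [Fintype ι'] {A : Matrix ι κ ℝ}
    {r : ι' → ι} (hr : r.Injective) {c : ι → ℝ} (hc : ∀ i ∉ Set.range r, c i = 0) :
    c ∘ r ∈ coeffLattice (A.submatrix r id) ↔ c ∈ coeffLattice A := by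
  have h1 : (c ∘ r) ᵥ* A.submatrix r id = c ᵥ* A := by
    ext k
    exact Fintype.sum_of_injective r hr _ _ (fun i hi => by rw [hc i hi, zero_mul])
      (fun i => rfl)
  rw [mem_coeffLattice, mem_coeffLattice, h1]

lemma IsZeroPmOne.apply_mem_of_support {ι κ : Type*} [Fintype ι] [DecidableEq ι]
    {A : Matrix ι κ ℝ} (hA : IsZeroPmOne A) (hli : LinearIndependent ℝ A.row) {c : ι → ℝ}
    (hc : c ∈ coeffLattice A) {i : ι} (hi : ∀ j, j ≠ i → c j = 0) : c i ∈ intReals := by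
  obtain ⟨k, hk⟩ := Function.ne_iff.1 (hli.ne_zero i)
  have h1 : (c ᵥ* A) k = c i * A i k :=
    Fintype.sum_eq_single i fun j hj => by rw [hi j hj, zero_mul]
  have h2 := hc k
  rw [h1] at h2
  rcases hA i k with h | h | h
  · exact absurd h hk
  · simpa [h] using h2
  · simpa [h] using h2

section Interlace

variable {n : ℕ} {κ : Type*} {A : Matrix (Fin n) κ ℝ}

lemma vec_pair_injective {i j : Fin n} (hij : i ≠ j) : Function.Injective ![i, j] := by
  intro a b hab
  fin_cases a <;> fin_cases b <;> simp_all [eq_comm]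

lemma IsTeInterlace.pair_half_mem [Fintype κ] (hA : IsTeInterlace A) {i j : Fin n} (hij : i ≠ j) :
    (Pi.single i (1 / 2) + Pi.single j (1 / 2) : Fin n → ℝ) ∈ coeffLattice A := by
  rw [← comp_mem_coeffLattice_iff (vec_pair_injective hij)]
  · convert (hA.2.2 i j hij).half_mem using 1
    ext a
    fin_cases a
    · simp [hij]
    · simp [hij.symm]
  · intro l hl
    have h1 : l ≠ i := fun h => hl ⟨0, by simp [h]⟩
    have h2 : l ≠ j := fun h => hl ⟨1, by simp [h]⟩
    simp [h1, h2]

lemma IsTeInterlace.pair_mem_or [Fintype κ] (hA : IsTeInterlace A) {i j : Fin n} (hij : i ≠ j)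
    {c : Fin n → ℝ} (hc : c ∈ coeffLattice A) (h0 : ∀ l, l ≠ i → l ≠ j → c l = 0) :
    (c i ∈ intReals ∧ c j ∈ intReals) ∨ (c i - 1 / 2 ∈ intReals ∧ c j - 1 / 2 ∈ intReals) := by
  rw [← comp_mem_coeffLattice_iff (vec_pair_injective hij)] at hc
  · rcases (hA.2.2 i j hij).forall_mem_or hc with h | h
    · exact Or.inl ⟨h 0, h 1⟩
    · exact Or.inr ⟨h 0, h 1⟩
  · intro l hl
    exact h0 l (fun h => hl ⟨0, by simp [h]⟩) (fun h => hl ⟨1, by simp [h]⟩)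

lemma IsTeInterlace.apply_mem_of_support (hA : IsTeInterlace A) {c : Fin n → ℝ}
    (hc : c ∈ coeffLattice A) {i : Fin n} (hi : ∀ j, j ≠ i → c j = 0) : c i ∈ intReals :=
  hA.1.1.apply_mem_of_support hA.1.2.1 hc hi

/-- All rows of a te-interlace have the same support. -/
lemma IsTeInterlace.apply_ne_zero [Fintype κ] (hA : IsTeInterlace A) {i : Fin n} {k : κ}
    (hi : A i k ≠ 0) (j : Fin n) : A j k ≠ 0 := by
  by_cases hij : i = j
  · exact hij ▸ hi
  intro hj
  have h1 := hA.pair_half_mem hij k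
  rw [add_vecMul, single_vecMul, single_vecMul] at h1
  simp only [Pi.add_apply, Pi.smul_apply, row_apply, smul_eq_mul, hj, mul_zero, add_zero] at h1
  refine hi ?_
  have := eq_zero_of_mem_intReals h1 (by
    rcases hA.1.1 i k with h | h | h <;> rw [h] <;> norm_num)
  linarith

lemma IsTeInterlace.apply_eq [Fintype κ] (hA : IsTeInterlace A) {i : Fin n} {k : κ}
    (hi : A i k ≠ 0) (j : Fin n) : A j k = 1 ∨ A j k = -1 :=
  (hA.1.1 j k).resolve_left (hA.apply_ne_zero hi j)

lemma IsTeInterlace.pos (hA : IsTeInterlace A) : 0 < n := by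
  rcases n.eq_zero_or_pos with rfl | h
  · exact absurd ⟨hA.1.1, hA.1.2.1, emptyRows_isTotallyUnimodular A⟩ hA.2.1
  · exact h

lemma IsTeInterlace.exists_ne_zero (hA : IsTeInterlace A) (i : Fin n) : ∃ k, A i k ≠ 0 :=
  Function.ne_iff.1 (hA.1.2.1.ne_zero i)

/-- A half-integral coefficient vector of an integer point has an even number of entries that are
not integers, since the entries of a nonzero column are odd. -/
lemma IsTeInterlace.sum_mem_intReals [Fintype κ] (hA : IsTeInterlace A) {c : Fin n → ℝ}
    (hc : c ∈ coeffLattice A) (h2 : ∀ i, 2 * c i ∈ intReals) : ∑ i, c i ∈ intReals := by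
  obtain ⟨k, hk⟩ := hA.exists_ne_zero ⟨0, hA.pos⟩
  have h1 : ∑ i, c i = (c ᵥ* A) k + ∑ i, c i * (1 - A i k) := by
    change _ = ∑ i, c i * A i k + _
    rw [← Finset.sum_add_distrib]
    exact Finset.sum_congr rfl fun i _ => by ring
  rw [h1]
  refine intReals.add_mem (hc k) (intReals.sum_mem fun i _ => ?_)
  rcases hA.apply_eq hk i with h | h <;> rw [h]
  · simp
  · have : c i * (1 - -1) = 2 * c i := by ring
    rw [this]; exact h2 i

end Interlace

/-- The matrix with rows `e₀` and `(e₀ + eⱼ) / 2` for `j ≠ 0`; they generate the half-integral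
vectors with an even number of entries that are not integers. -/
noncomputable def halfBasis (n : ℕ) : Matrix (Fin (n + 1)) (Fin (n + 1)) ℝ :=
  of (Fin.cons (Pi.single 0 1) fun j => Pi.single 0 (1 / 2) + Pi.single j.succ (1 / 2))

lemma det_halfBasis (n : ℕ) : (halfBasis n).det = (1 / 2) ^ n := by
  rw [det_of_isLowerTriangular]
  · rw [Fin.prod_univ_succ]
    simp [halfBasis]
  · intro i j hij
    have hij' : i < j := hij
    obtain ⟨j, rfl⟩ := Fin.exists_succ_eq.2 (Fin.pos_iff_ne_zero.1 ((Fin.zero_le i).trans_lt hij'))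
    refine Fin.cases (fun _ => ?_) (fun i h => ?_) i hij'
    · simp [halfBasis]
    · have : j ≠ i := fun h' => by simp [h'] at h
      simp [halfBasis, this]

lemma vecMul_halfBasis_zero {n : ℕ} (c : Fin (n + 1) → ℝ) :
    (c ᵥ* halfBasis n) 0 = c 0 + ∑ j : Fin n, c j.succ / 2 := by
  change ∑ i, c i * halfBasis n i 0 = _
  rw [Fin.sum_univ_succ]
  simp [halfBasis, div_eq_mul_inv]

lemma vecMul_halfBasis_succ {n : ℕ} (c : Fin (n + 1) → ℝ) (j : Fin n) :
    (c ᵥ* halfBasis n) j.succ = c j.succ / 2 := by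
  change ∑ i, c i * halfBasis n i j.succ = _
  rw [Fin.sum_univ_succ, Fintype.sum_eq_single j]
  · simp [halfBasis, div_eq_mul_inv]
  · intro i hi
    simp [halfBasis, hi.symm]

section Interlace

variable {n : ℕ} {κ : Type*} [Fintype κ] {A : Matrix (Fin (n + 1)) κ ℝ}

lemma IsTeInterlace.halfBasis_mem (hA : IsTeInterlace A) (i : Fin (n + 1)) :
    halfBasis n i ∈ coeffLattice A := by
  refine Fin.cases ?_ (fun j => ?_) i
  · refine mem_coeffLattice_of_forall_mem hA.1.1 fun l => ?_
    change (Pi.single 0 1 : Fin (n + 1) → ℝ) l ∈ _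
    rw [Pi.single_apply]
    split_ifs
    exacts [intReals.one_mem, intReals.zero_mem]
  · exact hA.pair_half_mem (Fin.succ_ne_zero j).symm

/-- A bound for the denominators of coefficients of integer points: passing to the basis
`halfBasis n` divides the determinant of a column submatrix by `2 ^ n`, and the basis change itself
costs one more factor `2`. -/
lemma IsTeInterlace.two_mul_det_mul_mem (hA : IsTeInterlace A) {f : Fin (n + 1) → κ}
    (hf : (A.submatrix id f).det ≠ 0) {c : Fin (n + 1) → ℝ} (hc : c ∈ coeffLattice A)
    (i : Fin (n + 1)) : 2 * ((1 / 2) ^ n * (A.submatrix id f).det) * c i ∈ intReals := by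
  set M := A.submatrix id f with hM
  set M' := halfBasis n * M with hM'
  have hdet : M'.det = (1 / 2) ^ n * M.det := by rw [hM', det_mul, det_halfBasis]
  have hdet0 : M'.det ≠ 0 := by rw [hdet]; positivity
  have hint : ∀ a b, M' a b ∈ intReals := fun a b => hA.halfBasis_mem a (f b)
  set c' := (c ᵥ* M) ᵥ* M'⁻¹ with hc'
  have h1 : c = c' ᵥ* halfBasis n := by
    refine vecMul_injective_of_det_ne_zero hf ?_
    rw [vecMul_vecMul c' (halfBasis n) M, ← hM', hc', vecMul_vecMul,
      nonsing_inv_mul _ (isUnit_iff_ne_zero.2 hdet0), vecMul_one]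
  have h2 : ∀ j, M'.det * c' j ∈ intReals := by
    intro j
    have : M'.det * c' j = ((c ᵥ* M) ᵥ* M'.adjugate) j := by
      rw [hc', inv_def, vecMul_smul, Pi.smul_apply, Ring.inverse_eq_inv', smul_eq_mul,
        mul_inv_cancel_left₀ hdet0]
    rw [this]
    change ∑ a, (c ᵥ* M) a * M'.adjugate a j ∈ intReals
    exact intReals.sum_mem fun a _ =>
      intReals.mul_mem (hc (f a)) (adjugate_mem_subring _ _ hint a j)
  rw [← hdet]
  have h3 : 2 * M'.det * c i = 2 * (M'.det * c i) := by ring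
  rw [h3, h1]
  refine Fin.cases ?_ (fun j => ?_) i
  · rw [vecMul_halfBasis_zero]
    have : 2 * (M'.det * (c' 0 + ∑ j : Fin n, c' j.succ / 2)) =
        (M'.det * c' 0 + M'.det * c' 0) + ∑ j : Fin n, M'.det * c' j.succ := by
      rw [← Finset.sum_div, ← Finset.mul_sum]; ring
    rw [this]
    exact intReals.add_mem (intReals.add_mem (h2 _) (h2 _)) (intReals.sum_mem fun j _ => h2 _)
  · rw [vecMul_halfBasis_succ]
    convert h2 j.succ using 1
    ring

/-- If the coefficients of all integer points are half-integral, then the integer vectors and the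
half sums generate the lattice, so that the maximal determinants for `n + 1` rows are at most
`2 ^ n` in absolute value. -/
lemma IsTeInterlace.abs_det_le_of_forall_half (hA : IsTeInterlace A) {f : Fin (n + 1) → κ}
    (hf : (A.submatrix id f).det ≠ 0)
    (h : ∀ c ∈ coeffLattice A, ∀ i, 2 * c i ∈ intReals) :
    |(1 / 2) ^ n * (A.submatrix id f).det| ≤ 1 := by
  set M := A.submatrix id f with hM
  let Q : Matrix (Fin (n + 1)) (Fin (n + 1)) ℝ := of fun i =>
    Fin.cons (M⁻¹ i 0 - ∑ j : Fin n, M⁻¹ i j.succ) fun j => 2 * M⁻¹ i j.succ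
  have hL : ∀ i, M⁻¹ i ∈ coeffLattice A := hA.1.hasEqualDets_self.inv_row_mem hf
  have hQ : Q * halfBasis n = M⁻¹ := by
    ext i l
    rw [mul_apply_eq_vecMul]
    refine Fin.cases ?_ (fun j => ?_) l
    · rw [vecMul_halfBasis_zero]
      simp [Q]
    · rw [vecMul_halfBasis_succ]
      simp [Q]
  have hQint : ∀ i j, Q i j ∈ intReals := by
    intro i j
    refine Fin.cases ?_ (fun j => ?_) j
    · have h1 : Q i 0 = 2 * M⁻¹ i 0 - ∑ j, M⁻¹ i j := by
        rw [Fin.sum_univ_succ]; simp [Q]; ring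
      rw [h1]
      exact intReals.sub_mem (h _ (hL i) 0) (hA.sum_mem_intReals (hL i) (h _ (hL i)))
    · exact h _ (hL i) j.succ
  have h1 : Q.det * ((1 / 2) ^ n * M.det) = 1 := by
    rw [← det_halfBasis, ← det_mul, ← det_mul, ← Matrix.mul_assoc, hQ,
      nonsing_inv_mul _ (isUnit_iff_ne_zero.2 hf), det_one]
  obtain ⟨d, hd⟩ := mem_intReals.1 (det_mem_subring intReals Q hQint)
  have h2 : |Q.det| * |(1 / 2) ^ n * M.det| = 1 := by rw [← abs_mul, h1, abs_one]
  have h3 : 1 ≤ |Q.det| := by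
    have hd0 : d ≠ 0 := by rintro rfl; simp [hd] at h1
    rw [hd]; exact_mod_cast Int.one_le_abs hd0
  nlinarith [abs_nonneg ((1 / 2) ^ n * M.det)]

end Interlace

lemma IsThinTeInterlace.two_mul_mem {n : ℕ} {κ : Type*} [Fintype κ] {A : Matrix (Fin n) κ ℝ}
    (hA : IsThinTeInterlace A) {c : Fin n → ℝ} (hc : c ∈ coeffLattice A) (i : Fin n) :
    2 * c i ∈ intReals := by
  obtain ⟨n, rfl⟩ := Nat.exists_eq_succ_of_ne_zero hA.1.pos.ne'
  obtain ⟨-, f, hf, hdet⟩ := hA.2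
  have h1 := hA.1.two_mul_det_mul_mem hf hc i
  rw [Nat.succ_sub_one] at hdet
  have h2 : (1 / 2 : ℝ) ^ n * 2 ^ n = 1 := by rw [← mul_pow]; norm_num
  rcases eq_or_eq_neg_of_abs_eq hdet with h | h <;> rw [h] at h1
  · rwa [h2, mul_one] at h1
  · rw [mul_neg, h2] at h1
    convert intReals.neg_mem h1 using 1
    ring

lemma IsThickTeInterlace.four_mul_mem {n : ℕ} {κ : Type*} [Fintype κ] {A : Matrix (Fin n) κ ℝ}
    (hA : IsThickTeInterlace A) {c : Fin n → ℝ} (hc : c ∈ coeffLattice A) (i : Fin n) :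
    4 * c i ∈ intReals := by
  obtain ⟨n, rfl⟩ := Nat.exists_eq_succ_of_ne_zero hA.1.pos.ne'
  obtain ⟨-, f, hf, hdet⟩ := hA.2
  have h1 := hA.1.two_mul_det_mul_mem hf hc i
  have h2 : (1 / 2 : ℝ) ^ n * 2 ^ n.succ = 2 := by
    rw [pow_succ, ← mul_assoc, ← mul_pow]; norm_num
  rcases eq_or_eq_neg_of_abs_eq hdet with h | h <;> rw [h] at h1
  · rw [h2] at h1; convert h1 using 1; ring
  · rw [mul_neg, h2] at h1
    convert intReals.neg_mem h1 using 1
    ring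

lemma IsThickTeInterlace.exists_not_half {n : ℕ} {κ : Type*} [Fintype κ]
    {A : Matrix (Fin n) κ ℝ} (hA : IsThickTeInterlace A) :
    ∃ c ∈ coeffLattice A, ∃ i, 2 * c i ∉ intReals := by
  by_contra! hcon
  obtain ⟨n, rfl⟩ := Nat.exists_eq_succ_of_ne_zero hA.1.pos.ne'
  obtain ⟨-, f, hf, hdet⟩ := hA.2
  have h1 := hA.1.abs_det_le_of_forall_half hf hcon
  have h2 : (1 / 2 : ℝ) ^ n * 2 ^ n.succ = 2 := by
    rw [pow_succ, ← mul_assoc, ← mul_pow]; norm_num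
  rw [abs_mul, hdet, abs_of_pos (by positivity), h2] at h1
  norm_num at h1

/-! ### The lattice of a thick te-interlace -/

lemma two_mul_add_mem {x y : ℝ} (hx4 : 4 * x ∈ intReals) (hy4 : 4 * y ∈ intReals)
    (hx : 2 * x ∉ intReals) (hy : 2 * y ∉ intReals) : 2 * (x + y) ∈ intReals := by
  have h1 : 2 * x - 1 / 2 ∈ intReals :=
    (mem_intReals_or_of_two_mul (by convert hx4 using 1; ring)).resolve_left hx
  have h2 : 2 * y - 1 / 2 ∈ intReals :=
    (mem_intReals_or_of_two_mul (by convert hy4 using 1; ring)).resolve_left hy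
  convert intReals.add_mem (intReals.add_mem h1 h2) intReals.one_mem using 1
  ring

lemma IsTeSet.submatrix {ι ι' κ : Type*} {A : Matrix ι κ ℝ} (hA : IsTeSet A) {r : ι' → ι}
    (hr : r.Injective) : IsTeSet (A.submatrix r id) :=
  ⟨fun _ _ => hA.1 _ _, hA.2.1.comp r hr, fun k r' hr' h => hA.2.2 k (r ∘ r') (hr.comp hr') h⟩

/-- If some integer point has a coefficient outside `ℤ/2` in row `l`, the same holds for every
nonzero entry in column `l` of the inverse of a nonsingular column submatrix: these entries have
the same absolute value, and the rows of the inverse generate the coefficient lattice. -/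
lemma IsTeSet.inv_apply_eq_zero_or {m : ℕ} {κ : Type*} {B : Matrix (Fin (m + 1)) κ ℝ}
    (hB : IsTeSet B) {f : Fin (m + 1) → κ} (hf : (B.submatrix id f).det ≠ 0)
    {u : Fin (m + 1) → ℝ} (hu : u ∈ coeffLattice B) {l : Fin (m + 1)}
    (hul : 2 * u l ∉ intReals) (j : Fin (m + 1)) :
    (B.submatrix id f)⁻¹ j l = 0 ∨ 2 * (B.submatrix id f)⁻¹ j l ∉ intReals := by
  by_contra! hcon
  obtain ⟨h0, hhalf⟩ := hcon
  refine hul ?_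
  rw [eq_sum_inv_rows hf u, Finset.sum_apply, Finset.mul_sum]
  refine intReals.sum_mem fun i _ => ?_
  rw [Pi.smul_apply, smul_eq_mul, mul_left_comm]
  refine intReals.mul_mem (hu (f i)) ?_
  by_cases hi : (B.submatrix id f)⁻¹ i l = 0
  · rw [hi, mul_zero]; exact intReals.zero_mem
  · rcases abs_eq_abs.1 (abs_inv_apply_eq (hB.hasEqualDets Fin.succAbove_right_injective) hi h0)
      with h | h <;> rw [h]
    · exact hhalf
    · rw [mul_neg]; exact intReals.neg_mem hhalf

/-- In a te-set with all entries `±1` in the nonzero columns, a set of rows carrying a coefficient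
vector with all entries outside `ℤ/2`, on which all other coefficient vectors are entirely in `ℤ/2`
or entirely outside, cannot be extended by one more row, here the row `0`.  All rows of the inverse
`M⁻¹` of a nonsingular column submatrix are outside `ℤ/2` on the row set, and the same holds for a
nonsingular submatrix `N` that omits row `0` and a column `i`.  A row of `N⁻¹` is the sum of a row
of `M⁻¹` and `t ∈ {0, ±1}` times row `i` of `M⁻¹`; by parity `t = 0`, so that column `i` would
vanish on the row set. -/
lemma IsTeSet.false_of_extension {m : ℕ} {κ : Type*} [Fintype κ] {B : Matrix (Fin (m + 2)) κ ℝ}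
    (hB : IsTeSet B) (hsupp : ∀ i j k, B i k ≠ 0 → B j k ≠ 0) {u : Fin (m + 2) → ℝ}
    (hu : u ∈ coeffLattice B) (hu0 : u 0 = 0) (husucc : ∀ l : Fin (m + 1), 2 * u l.succ ∉ intReals)
    (h4 : ∀ c ∈ coeffLattice B, ∀ l, 4 * c l ∈ intReals)
    (hall : ∀ c ∈ coeffLattice B, (∀ l : Fin (m + 1), 2 * c l.succ ∈ intReals) ∨
      ∀ l : Fin (m + 1), 2 * c l.succ ∉ intReals) : False := by
  classical
  obtain ⟨f, hf⟩ := exists_submatrix_det_ne_zero hB.2.1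
  set M := B.submatrix id f with hM
  have hYL : ∀ i, M⁻¹ i ∈ coeffLattice B := hB.hasEqualDets_self.inv_row_mem hf
  have hMne : ∀ i a, M i a ≠ 0 := by
    intro i a h0
    refine hf (det_eq_zero_of_column_eq_zero a fun j => ?_)
    by_contra hj
    exact hsupp j i (f a) hj h0
  have hYodd : ∀ j (l : Fin (m + 1)), 2 * M⁻¹ j l.succ ∉ intReals := by
    intro j
    refine (hall _ (hYL j)).resolve_left fun heven => ?_
    have hz : ∀ l : Fin (m + 1), M⁻¹ j l.succ = 0 := fun l =>
      (hB.inv_apply_eq_zero_or hf hu (husucc l) j).resolve_right fun h => h (heven l)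
    obtain ⟨a, ha⟩ := exists_ne j
    have h1 := congrFun (inv_row_vecMul hf j) a
    rw [Pi.single_eq_of_ne ha] at h1
    change ∑ i, M⁻¹ j i * M i a = 0 at h1
    rw [Fin.sum_univ_succ, Finset.sum_eq_zero (fun l _ => by rw [hz l, zero_mul]), add_zero] at h1
    refine inv_row_ne_zero hf j (funext fun l => ?_)
    refine Fin.cases ?_ hz l
    exact (mul_eq_zero.1 h1).resolve_right (hMne 0 a)
  obtain ⟨i, hi⟩ : ∃ i, M⁻¹ i 0 ≠ 0 := by
    by_contra! hcon
    have h1 : (M * M⁻¹) 0 0 = 1 := by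
      rw [mul_nonsing_inv _ (isUnit_iff_ne_zero.2 hf), one_apply_eq]
    rw [mul_apply] at h1
    simp [hcon] at h1
  set C := B.submatrix Fin.succ id with hC
  have hCte : IsTeSet C := hB.submatrix (Fin.succ_injective _)
  have hg : (C.submatrix id (f ∘ i.succAbove)).det ≠ 0 := by
    intro h0
    refine hi ?_
    rw [inv_apply_eq_adjugate_div, adjugate_fin_succ_eq_det_submatrix, Fin.succAbove_zero]
    have : M.submatrix Fin.succ i.succAbove = C.submatrix id (f ∘ i.succAbove) := rfl
    rw [this, h0, mul_zero, zero_div]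
  set N := C.submatrix id (f ∘ i.succAbove) with hN
  have hcons : ∀ c : Fin (m + 1) → ℝ, c ∈ coeffLattice C →
      (Fin.cons 0 c : Fin (m + 2) → ℝ) ∈ coeffLattice B := by
    intro c hc
    refine (comp_mem_coeffLattice_iff (Fin.succ_injective _) ?_).1 hc
    intro l hl
    rw [Fin.range_succ] at hl
    have : l = 0 := by simpa using hl
    rw [this, Fin.cons_zero]
  have huC : u ∘ Fin.succ ∈ coeffLattice C := by
    refine (comp_mem_coeffLattice_iff (Fin.succ_injective _) ?_).2 hu
    intro l hl
    rw [Fin.range_succ] at hl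
    have : l = 0 := by simpa using hl
    rw [this, hu0]
  have hZL : ∀ j, N⁻¹ j ∈ coeffLattice C := hCte.hasEqualDets_self.inv_row_mem hg
  have hZodd : ∀ j l, 2 * N⁻¹ j l ∉ intReals := by
    intro j
    refine (hall _ (hcons _ (hZL j))).resolve_left fun heven => ?_
    exact inv_row_ne_zero hg j (funext fun l =>
      (hCte.inv_apply_eq_zero_or hg huC (husucc l) j).resolve_right fun h => h (heven l))
  have ht : ∀ j, (N⁻¹ *ᵥ fun a => C a (f i)) j = 0 := by
    intro j
    set t := (N⁻¹ *ᵥ fun a => C a (f i)) j with ht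
    have hdecomp : (Fin.cons 0 (N⁻¹ j) : Fin (m + 2) → ℝ) =
        M⁻¹ (i.succAbove j) + t • M⁻¹ i := by
      refine vecMul_injective_of_det_ne_zero hf ?_
      rw [add_vecMul, smul_vecMul, inv_row_vecMul hf, inv_row_vecMul hf]
      have hleft : ∀ a, ((Fin.cons 0 (N⁻¹ j) : Fin (m + 2) → ℝ) ᵥ* M) a =
          ∑ l, N⁻¹ j l * C l (f a) := by
        intro a
        change ∑ l, (Fin.cons 0 (N⁻¹ j) : Fin (m + 2) → ℝ) l * M l a = _
        rw [Fin.sum_univ_succ]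
        simp [hM, hC]
      ext a
      rw [hleft]
      rcases Fin.eq_self_or_eq_succAbove i a with rfl | ⟨b, rfl⟩
      · simp [(Fin.succAbove_ne a j).symm, ht, mulVec, dotProduct]
      · have h1 := congrFun (inv_row_vecMul hg j) b
        change ∑ l, N⁻¹ j l * C l (f (i.succAbove b)) = _ at h1
        rw [h1]
        simp [Pi.single_apply, Fin.succAbove_ne]
    have h1 := congrFun hdecomp (0 : Fin (m + 1)).succ
    rw [Fin.cons_succ, Pi.add_apply, Pi.smul_apply, smul_eq_mul] at h1
    have hq : ∀ j, 4 * M⁻¹ j (0 : Fin (m + 1)).succ ∈ intReals := fun j => h4 _ (hYL j) _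
    rcases hCte.hasEqualDets_self.inv_mulVec hg (f i) j with h | h | h
    · exact h
    · refine absurd ?_ (hZodd j 0)
      rw [h1, ht, h, one_mul]
      exact two_mul_add_mem (hq _) (hq _) (hYodd _ _) (hYodd _ _)
    · refine absurd ?_ (hZodd j 0)
      rw [h1, ht, h, neg_one_mul]
      refine two_mul_add_mem (hq _) ?_ (hYodd _ _) ?_
      · rw [mul_neg]; exact intReals.neg_mem (hq _)
      · rw [mul_neg, neg_mem_iff]; exact hYodd _ _
  have hcol : (fun a => C a (f i)) = 0 := by
    have h1 : N *ᵥ (N⁻¹ *ᵥ fun a => C a (f i)) = fun a => C a (f i) := by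
      rw [mulVec_mulVec, mul_nonsing_inv _ (isUnit_iff_ne_zero.2 hg), one_mulVec]
    rw [← h1, funext ht]
    exact mulVec_zero _
  exact hMne (0 : Fin (m + 1)).succ i (congrFun hcol 0)

section Thick

variable {n : ℕ} {κ : Type*} [Fintype κ] {A : Matrix (Fin n) κ ℝ}

open Classical in
/-- The rows in which a coefficient vector is not half-integral. -/
noncomputable def quarterSupport {n : ℕ} (c : Fin n → ℝ) : Finset (Fin n) :=
  Finset.univ.filter fun i => 2 * c i ∉ intReals

lemma mem_quarterSupport {c : Fin n → ℝ} {i : Fin n} :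
    i ∈ quarterSupport c ↔ 2 * c i ∉ intReals := by
  simp [quarterSupport]

/-- Half-integral entries can be removed by half sums of two rows, one of them in the support. -/
lemma IsTeInterlace.exists_supported (hA : IsTeInterlace A) {u : Fin n → ℝ}
    (hu : u ∈ coeffLattice A) (hne : (quarterSupport u).Nonempty) :
    ∃ v ∈ coeffLattice A, (∀ i ∉ quarterSupport u, v i = 0) ∧
      ∀ i ∈ quarterSupport u, 2 * v i ∉ intReals := by
  classical
  obtain ⟨s, hs⟩ := hne
  set O := quarterSupport u with hO
  have hhalf : ∀ i ∈ Oᶜ, 2 * u i ∈ intReals := by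
    intro i hi
    rw [Finset.mem_compl, hO, mem_quarterSupport, not_not] at hi
    exact hi
  set w : Fin n → ℝ := ∑ i ∈ Oᶜ, (2 * u i) • (Pi.single i (1 / 2) + Pi.single s (1 / 2)) with hw
  have hwL : w ∈ coeffLattice A := by
    refine sum_mem fun i hi => smul_mem_coeffLattice (hhalf i hi) (hA.pair_half_mem ?_)
    rintro rfl
    exact Finset.mem_compl.1 hi hs
  refine ⟨u - w, sub_mem hu hwL, ?_, ?_⟩
  · intro l hl
    have hls : l ≠ s := fun h => hl (h ▸ hs)
    rw [Pi.sub_apply, hw, Finset.sum_apply, Finset.sum_eq_single l]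
    · simp [hls]; ring
    · intro i _ hil
      simp [hls, Ne.symm hil]
    · intro h; exact absurd (Finset.mem_compl.2 hl) h
  · intro l hl h2
    refine mem_quarterSupport.1 hl ?_
    have h3 : 2 * w l ∈ intReals := by
      rw [hw, Finset.sum_apply, Finset.mul_sum]
      refine intReals.sum_mem fun i hi => ?_
      have hil : l ≠ i := fun h => Finset.mem_compl.1 hi (h ▸ hl)
      by_cases hls : l = s
      · subst hls
        convert hhalf i hi using 1
        simp [hil]; ring
      · simp [hil, hls]
    convert intReals.add_mem h2 h3 using 1
    rw [Pi.sub_apply]; ring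

lemma IsTeInterlace.not_quarterSupport_subset_pair (hA : IsTeInterlace A) {u : Fin n → ℝ}
    (hu : u ∈ coeffLattice A) (hne : (quarterSupport u).Nonempty) {i j : Fin n} (hij : i ≠ j)
    (hsub : quarterSupport u ⊆ {i, j}) : False := by
  obtain ⟨v, hv, hv0, hv1⟩ := hA.exists_supported hu hne
  have h0 : ∀ l, l ≠ i → l ≠ j → v l = 0 := fun l hi hj => hv0 l fun h => by
    have := hsub h
    simp [hi, hj] at this
  have hhalf : 2 * v i ∈ intReals ∧ 2 * v j ∈ intReals := by
    have htwo : ∀ x, x - 1 / 2 ∈ intReals → 2 * x ∈ intReals := fun x hx => by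
      convert intReals.add_mem (intReals.add_mem hx hx) intReals.one_mem using 1; ring
    have htwo' : ∀ x, x ∈ intReals → 2 * x ∈ intReals := fun x hx => by
      rw [two_mul]; exact intReals.add_mem hx hx
    rcases hA.pair_mem_or hij hv h0 with h | h
    · exact ⟨htwo' _ h.1, htwo' _ h.2⟩
    · exact ⟨htwo _ h.1, htwo _ h.2⟩
  obtain ⟨l, hl⟩ := hne
  have := hsub hl
  rw [Finset.mem_insert, Finset.mem_singleton] at this
  rcases this with rfl | rfl
  · exact hv1 _ hl hhalf.1
  · exact hv1 _ hl hhalf.2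

/-- In a thick te-interlace a coefficient vector that is not half-integral has all its entries
outside `ℤ/2`.  A support of minimal size that omits a row `k` has the properties that
`IsTeSet.false_of_extension` excludes: a coefficient vector that splits the support would, by
minimality, omit exactly one of its rows `s`, and the sum of the two vectors would have the
support `{s, k}`. -/
lemma IsThickTeInterlace.forall_half_or (hA : IsThickTeInterlace A) {c : Fin n → ℝ}
    (hc : c ∈ coeffLattice A) :
    (∀ i, 2 * c i ∈ intReals) ∨ ∀ i, 2 * c i ∉ intReals := by
  classical
  have hex : ∃ N, ∃ u ∈ coeffLattice A, (quarterSupport u).Nonempty ∧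
      (quarterSupport u).card = N := by
    obtain ⟨u, hu, i, hi⟩ := hA.exists_not_half
    exact ⟨_, u, hu, ⟨i, mem_quarterSupport.2 hi⟩, rfl⟩
  obtain ⟨u', hu', hne, hcard⟩ := Nat.find_spec hex
  have hmin : ∀ c ∈ coeffLattice A, (quarterSupport c).Nonempty →
      (quarterSupport u').card ≤ (quarterSupport c).card := fun c hc h => by
    rw [hcard]; exact Nat.find_min' hex ⟨c, hc, h, rfl⟩
  set S := quarterSupport u' with hS
  suffices huniv : S = Finset.univ by
    by_cases h : (quarterSupport c).Nonempty
    · right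
      intro i
      have h1 := hmin c hc h
      rw [huniv] at h1
      have h2 : quarterSupport c = Finset.univ :=
        (Finset.card_eq_iff_eq_univ _).1
          (le_antisymm (Finset.card_le_univ _) (by simpa using h1))
      exact mem_quarterSupport.1 (h2 ▸ Finset.mem_univ i)
    · left
      intro i
      by_contra hi
      exact h ⟨i, mem_quarterSupport.2 hi⟩
  by_contra hSne
  obtain ⟨k, hk⟩ : ∃ k, k ∉ S := by
    by_contra! h
    exact hSne (Finset.eq_univ_iff_forall.2 h)
  obtain ⟨u, hu, hu0, hu1⟩ := hA.1.exists_supported hu' hne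
  obtain ⟨m, hm⟩ := Nat.exists_eq_succ_of_ne_zero (Finset.card_pos.2 hne).ne'
  let r : Fin (m + 1) → Fin n := S.orderEmbOfFin hm
  have hrS : Set.range r = S := Finset.range_orderEmbOfFin S hm
  have hrmem : ∀ a, r a ∈ S := fun a => Finset.orderEmbOfFin_mem S hm a
  let r' : Fin (m + 2) → Fin n := Fin.cons k r
  have hr' : Function.Injective r' := by
    rw [Fin.cons_injective_iff]
    refine ⟨?_, (S.orderEmbOfFin hm).injective⟩
    rw [hrS]; exact hk
  have hr'range : ∀ i, i ∉ Set.range r' ↔ i ≠ k ∧ i ∉ S := by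
    intro i
    rw [Fin.range_cons, hrS]
    simp
  have hext : ∀ c ∈ coeffLattice (A.submatrix r' id), ∃ c' ∈ coeffLattice A,
      c' ∘ r' = c ∧ ∀ i, i ≠ k → i ∉ S → c' i = 0 := by
    intro c hc
    have h1 : Function.extend r' c 0 ∘ r' = c := Function.extend_comp hr' _ _
    have h0 : ∀ i ∉ Set.range r', Function.extend r' c 0 i = 0 := fun i hi =>
      Function.extend_apply' _ _ _ hi
    refine ⟨Function.extend r' c 0, ?_, h1, fun i hi hi' => h0 i ((hr'range i).2 ⟨hi, hi'⟩)⟩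
    rw [← comp_mem_coeffLattice_iff hr' h0, h1]; exact hc
  refine (hA.1.1.submatrix hr').false_of_extension (u := u ∘ r')
    (fun i j a h => hA.1.apply_ne_zero h _) ?_ (hu0 k hk) (fun l => hu1 _ (hrmem l)) ?_ ?_
  · exact (comp_mem_coeffLattice_iff hr' fun i hi => hu0 i ((hr'range i).1 hi).2).2 hu
  · intro c hc l
    obtain ⟨c', hc', rfl, -⟩ := hext c hc
    exact hA.four_mul_mem hc' _
  · intro c hc
    obtain ⟨c', hc', rfl, hc0⟩ := hext c hc
    change (∀ l, 2 * c' (r l) ∈ intReals) ∨ ∀ l, 2 * c' (r l) ∉ intReals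
    by_contra! hcon
    obtain ⟨⟨a, ha⟩, b, hb⟩ := hcon
    set T := quarterSupport c' with hT
    have haT : r a ∈ T := mem_quarterSupport.2 ha
    have hbT : r b ∉ T := fun h => mem_quarterSupport.1 h hb
    have hTsub : T ⊆ insert k S := by
      intro i hi
      by_contra hcon
      rw [Finset.mem_insert, not_or] at hcon
      have := mem_quarterSupport.1 hi
      rw [hc0 i hcon.1 hcon.2] at this
      simp at this
    have hTcard : S.card ≤ T.card := hmin c' hc' ⟨_, haT⟩
    -- The support misses only the row `s = r b` of `S ∪ {k}`.
    have hTeq : T = (insert k S).erase (r b) := by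
      refine Finset.eq_of_subset_of_card_le (fun i hi => Finset.mem_erase.2
        ⟨fun h => hbT (h ▸ hi), hTsub hi⟩) ?_
      rw [Finset.card_erase_of_mem (Finset.mem_insert_of_mem (hrmem b)),
        Finset.card_insert_of_notMem hk]
      exact hTcard
    have hkb : r b ≠ k := fun h => hk (h ▸ hrmem b)
    have hsum := add_mem hu hc'
    refine hA.1.not_quarterSupport_subset_pair hsum ⟨r b, ?_⟩ hkb ?_
    · rw [mem_quarterSupport, Pi.add_apply, mul_add]
      intro h
      refine hu1 _ (hrmem b) ?_
      simpa using intReals.sub_mem h hb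
    · intro i hi
      by_contra hcon
      rw [Finset.mem_insert, Finset.mem_singleton, not_or] at hcon
      refine mem_quarterSupport.1 hi ?_
      by_cases hiS : i ∈ S
      · have hiT : i ∈ T := by
          rw [hTeq]; exact Finset.mem_erase.2 ⟨hcon.1, Finset.mem_insert_of_mem hiS⟩
        exact two_mul_add_mem (hA.four_mul_mem hu i) (hA.four_mul_mem hc' i) (hu1 i hiS)
          (mem_quarterSupport.1 hiT)
      · rw [Pi.add_apply, hu0 i hiS, hc0 i hcon.2 hiS]
        simp

end Thick

/-! ### Indecomposable vectors and generation -/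

section Elements

variable {n : ℕ} {κ : Type*} {A : Matrix (Fin n) κ ℝ}

lemma range_row_eq_image :
    Set.range A.row = (fun c => c ᵥ* A) '' Set.range fun i => (Pi.single i 1 : Fin n → ℝ) := by
  rw [← Set.range_comp]
  congr 1
  ext i : 1
  simp

lemma smul_sum_row_eq (t : ℝ) : t • ∑ j, A.row j = (fun _ => t) ᵥ* A := by
  rw [vecMul_eq_sum, Finset.smul_sum]; rfl

/-- The coefficient vectors of the half sums of two rows. -/
def pairHalves (n : ℕ) : Set (Fin n → ℝ) :=
  {x | ∃ i j, i < j ∧ x = Pi.single i (1 / 2) + Pi.single j (1 / 2)}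

/-- The coefficient vectors with one entry `3/4` and all others `1/4`. -/
def threeQuarters (n : ℕ) : Set (Fin n → ℝ) :=
  Set.range fun i => Pi.single i (1 / 2) + fun _ => 1 / 4

lemma pairHalfSums_eq_image : pairHalfSums A = (fun c => c ᵥ* A) '' pairHalves n := by
  have key : ∀ i j, (1 / 2 : ℝ) • (A.row i + A.row j) =
      (Pi.single i (1 / 2) + Pi.single j (1 / 2)) ᵥ* A := fun i j => by
    rw [add_vecMul, single_vecMul, single_vecMul, smul_add]
  ext x
  constructor
  · rintro ⟨i, j, hij, rfl⟩
    exact ⟨_, ⟨i, j, hij, rfl⟩, (key i j).symm⟩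
  · rintro ⟨_, ⟨i, j, hij, rfl⟩, rfl⟩
    exact ⟨i, j, hij, (key i j).symm⟩

lemma threeQuarterSums_eq_image : threeQuarterSums A = (fun c => c ᵥ* A) '' threeQuarters n := by
  have key : ∀ i, (3 / 4 : ℝ) • A.row i + (1 / 4 : ℝ) • ∑ j ∈ Finset.univ.erase i, A.row j =
      (Pi.single i (1 / 2) + fun _ => 1 / 4) ᵥ* A := fun i => by
    rw [add_vecMul, single_vecMul, ← smul_sum_row_eq,
      ← Finset.add_sum_erase _ _ (Finset.mem_univ i), smul_add, ← add_assoc, ← add_smul]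
    norm_num
  ext x
  constructor
  · rintro ⟨i, rfl⟩
    exact ⟨_, ⟨i, rfl⟩, (key i).symm⟩
  · rintro ⟨_, ⟨i, rfl⟩, rfl⟩
    exact ⟨i, (key i).symm⟩

lemma pairHalves_finite : (pairHalves n).Finite := by
  refine (Set.finite_range fun p : Fin n × Fin n =>
    (Pi.single p.1 (1 / 2) + Pi.single p.2 (1 / 2) : Fin n → ℝ)).subset ?_
  rintro _ ⟨i, j, -, rfl⟩
  exact ⟨(i, j), rfl⟩

lemma eq_zero_of_mem_intReals_of_lt_one {x : ℝ} (hx : x ∈ intReals) (h0 : 0 ≤ x) (h1 : x < 1) :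
    x = 0 := eq_zero_of_mem_intReals hx (by rwa [abs_of_nonneg h0])

lemma half_notMem_intReals : (1 / 2 : ℝ) ∉ intReals := fun h => by
  have := eq_zero_of_mem_intReals_of_lt_one h (by norm_num) (by norm_num)
  norm_num at this

lemma single_one_mem (hA : IsZeroPmOne A) (i : Fin n) :
    (Pi.single i 1 : Fin n → ℝ) ∈ coeffLattice A :=
  mem_coeffLattice_of_forall_mem hA fun j => by
    rw [Pi.single_apply]
    split_ifs
    exacts [intReals.one_mem, intReals.zero_mem]

lemma single_indecomposable (hA : IsZeroPmOne A) (hli : LinearIndependent ℝ A.row) (i : Fin n)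
    {y : Fin n → ℝ} (hy : y ∈ coeffLattice A) (h0 : 0 ≤ y) (h1 : y ≤ Pi.single i 1) :
    y = 0 ∨ y = Pi.single i 1 := by
  have hsupp : ∀ j, j ≠ i → y j = 0 := fun j hj =>
    le_antisymm (by simpa [hj] using h1 j) (h0 j)
  have hi := hA.apply_mem_of_support hli hy hsupp
  have hle : y i ≤ 1 := by simpa using h1 i
  rcases hle.lt_or_eq with hlt | heq
  · left
    ext j
    by_cases hj : j = i
    · subst hj; exact eq_zero_of_mem_intReals_of_lt_one hi (h0 j) hlt
    · exact hsupp j hj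
  · right
    ext j
    by_cases hj : j = i
    · subst hj; simpa using heq
    · simpa [hj] using hsupp j hj

/-- Reduction to coefficients below `1`: rows can always be subtracted. -/
lemma single_le_or_lt {c : Fin n → ℝ} (hc : 0 ≤ c) :
    (∃ i, (Pi.single i 1 : Fin n → ℝ) ≤ c) ∨ ∀ i, c i < 1 := by
  by_cases h : ∃ i, 1 ≤ c i
  · obtain ⟨i, hi⟩ := h
    refine Or.inl ⟨i, fun j => ?_⟩
    by_cases hj : j = i
    · subst hj; simpa using hi
    · simpa [hj] using hc j
  · push Not at h
    exact Or.inr h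

lemma exists_quarter_le_single (i : Fin n) : ∃ j, (1 / 4 : ℝ) ≤ (Pi.single i 1 : Fin n → ℝ) j :=
  ⟨i, by norm_num⟩

lemma zero_le_single (i : Fin n) {t : ℝ} (ht : 0 ≤ t) : (0 : Fin n → ℝ) ≤ Pi.single i t :=
  Pi.single_nonneg.2 ht

end Elements

lemma IsTuSet.isHilbertBasis {n : ℕ} {κ : Type*} [Fintype κ] {A : Matrix (Fin n) κ ℝ}
    (hA : IsTuSet A) : IsHilbertBasis (rowCone A) (Set.range A.row) := by
  rw [range_row_eq_image]
  refine isHilbertBasis_image hA.2.1 (Set.finite_range _) ?_ ?_ ?_ ?_ ?_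
  · rintro _ ⟨i, rfl⟩; exact single_one_mem hA.1 i
  · rintro _ ⟨i, rfl⟩; exact zero_le_single i zero_le_one
  · rintro _ ⟨i, rfl⟩; exact exists_quarter_le_single i
  · rintro _ ⟨i, rfl⟩ y hy h0 h1; exact single_indecomposable hA.1 hA.2.1 i hy h0 h1
  · intro c hc h0 hne
    rcases single_le_or_lt h0 with ⟨i, hi⟩ | hlt
    · exact ⟨_, ⟨i, rfl⟩, hi⟩
    · exact absurd (funext fun i =>
        eq_zero_of_mem_intReals_of_lt_one (hA.apply_mem_intReals hc i) (h0 i) (hlt i)) hne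

lemma eq_half_of_lt_one {x : ℝ} (hx : x - 1 / 2 ∈ intReals) (h0 : 0 ≤ x) (h1 : x < 1) :
    x = 1 / 2 := by
  have := eq_zero_of_mem_intReals hx (abs_lt.2 ⟨by linarith, by linarith⟩)
  linarith

lemma IsTeLace.isHilbertBasis {n : ℕ} {κ : Type*} [Fintype κ] {A : Matrix (Fin n) κ ℝ}
    (hA : IsTeLace A) :
    IsHilbertBasis (rowCone A) (Set.range A.row ∪ {(1 / 2 : ℝ) • ∑ j, A.row j}) := by
  rw [range_row_eq_image, smul_sum_row_eq,
    ← Set.image_singleton (f := fun c => c ᵥ* A), ← Set.image_union]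
  refine isHilbertBasis_image hA.1.2.1 ((Set.finite_range _).union (Set.finite_singleton _))
    ?_ ?_ ?_ ?_ ?_
  · rintro _ (⟨i, rfl⟩ | rfl)
    exacts [single_one_mem hA.1.1 i, hA.half_mem]
  · rintro _ (⟨i, rfl⟩ | rfl)
    · exact zero_le_single i zero_le_one
    · intro i; norm_num
  · rintro _ (⟨i, rfl⟩ | rfl)
    · exact exists_quarter_le_single i
    · exact ⟨⟨0, hA.pos⟩, by norm_num⟩
  · rintro _ (⟨i, rfl⟩ | rfl) y hy h0 h1
    · exact single_indecomposable hA.1.1 hA.1.2.1 i hy h0 h1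
    · have hlt : ∀ i, y i < 1 := fun i => (h1 i).trans_lt (by norm_num)
      rcases hA.forall_mem_or hy with h | h
      · exact Or.inl (funext fun i => eq_zero_of_mem_intReals_of_lt_one (h i) (h0 i) (hlt i))
      · exact Or.inr (funext fun i => eq_half_of_lt_one (h i) (h0 i) (hlt i))
  · intro c hc h0 hne
    rcases single_le_or_lt h0 with ⟨i, hi⟩ | hlt
    · exact ⟨_, Or.inl ⟨i, rfl⟩, hi⟩
    · rcases hA.forall_mem_or hc with h | h
      · exact absurd (funext fun i =>
          eq_zero_of_mem_intReals_of_lt_one (h i) (h0 i) (hlt i)) hne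
      · exact ⟨_, Or.inr rfl, fun i => (eq_half_of_lt_one (h i) (h0 i) (hlt i)).ge⟩

section Interlace

variable {n : ℕ} {κ : Type*} {A : Matrix (Fin n) κ ℝ}

lemma IsTeInterlace.pairHalf_indecomposable [Fintype κ] (hA : IsTeInterlace A) {i j : Fin n}
    (hij : i ≠ j) {y : Fin n → ℝ} (hy : y ∈ coeffLattice A) (h0 : 0 ≤ y)
    (h1 : y ≤ Pi.single i (1 / 2) + Pi.single j (1 / 2)) :
    y = 0 ∨ y = Pi.single i (1 / 2) + Pi.single j (1 / 2) := by
  have hsupp : ∀ l, l ≠ i → l ≠ j → y l = 0 := fun l hi hj =>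
    le_antisymm (by simpa [hi, hj] using h1 l) (h0 l)
  have hi : y i < 1 := (h1 i).trans_lt (by simp [hij]; norm_num)
  have hj : y j < 1 := (h1 j).trans_lt (by simp [hij.symm]; norm_num)
  rcases hA.pair_mem_or hij hy hsupp with h | h
  · left
    ext l
    by_cases hli : l = i
    · subst hli; exact eq_zero_of_mem_intReals_of_lt_one h.1 (h0 _) hi
    by_cases hlj : l = j
    · subst hlj; exact eq_zero_of_mem_intReals_of_lt_one h.2 (h0 _) hj
    exact hsupp l hli hlj
  · right
    ext l
    by_cases hli : l = i
    · subst hli; simpa [hij] using eq_half_of_lt_one h.1 (h0 _) hi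
    by_cases hlj : l = j
    · subst hlj; simpa [hij.symm] using eq_half_of_lt_one h.2 (h0 _) hj
    simpa [hli, hlj] using hsupp l hli hlj

lemma pairHalf_le {c : Fin n → ℝ} (hc : 0 ≤ c) {i j : Fin n} (hij : i ≠ j) (hi : 1 / 2 ≤ c i)
    (hj : 1 / 2 ≤ c j) : ∃ x ∈ pairHalves n, x ≤ c := by
  wlog hlt : i < j generalizing i j
  · exact this hij.symm hj hi (lt_of_le_of_ne (not_lt.1 hlt) hij.symm)
  refine ⟨_, ⟨i, j, hlt, rfl⟩, fun l => ?_⟩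
  by_cases hli : l = i
  · subst hli; simpa [hij] using hi
  by_cases hlj : l = j
  · subst hlj; simpa [hij.symm] using hj
  simpa [hli, hlj] using hc l

/-- A half-integral coefficient vector with entries below `1` has at least two entries `1/2`: a
single one is excluded because an integer multiple of one row has an integer coefficient. -/
lemma IsTeInterlace.exists_pairHalf_le (hA : IsTeInterlace A) {c : Fin n → ℝ}
    (hc : c ∈ coeffLattice A) (h0 : 0 ≤ c) (hne : c ≠ 0) (hlt : ∀ i, c i < 1)
    (h2 : ∀ i, 2 * c i ∈ intReals) : ∃ x ∈ pairHalves n, x ≤ c := by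
  have hor : ∀ i, c i = 0 ∨ c i = 1 / 2 := fun i =>
    (mem_intReals_or_of_two_mul (h2 i)).imp
      (fun h => eq_zero_of_mem_intReals_of_lt_one h (h0 i) (hlt i))
      (fun h => eq_half_of_lt_one h (h0 i) (hlt i))
  obtain ⟨i, hi⟩ := Function.ne_iff.1 hne
  have hi' : c i = 1 / 2 := (hor i).resolve_left hi
  by_cases hex : ∃ j, j ≠ i ∧ c j ≠ 0
  · obtain ⟨j, hji, hj⟩ := hex
    exact pairHalf_le h0 hji ((hor j).resolve_left hj).ge hi'.ge
  · push Not at hex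
    have := hA.apply_mem_of_support hc hex
    rw [hi'] at this
    exact absurd this half_notMem_intReals

/-- The part common to thin and thick te-interlaces: the rows and the half sums of two rows, with a
further set `Y` of indecomposable vectors that takes care of the coefficient vectors that are not
half-integral. -/
lemma IsTeInterlace.isHilbertBasis_union [Fintype κ] (hA : IsTeInterlace A) {Y : Set (Fin n → ℝ)}
    (hfin : Y.Finite) (hL : ∀ x ∈ Y, x ∈ coeffLattice A) (hquarter : ∀ x ∈ Y, ∀ i, 1 / 4 ≤ x i)
    (hirr : ∀ x ∈ Y, ∀ y ∈ coeffLattice A, 0 ≤ y → y ≤ x → y = 0 ∨ y = x)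
    (hgen : ∀ c ∈ coeffLattice A, 0 ≤ c → (∀ i, c i < 1) → (∃ i, 2 * c i ∉ intReals) →
      ∃ x ∈ pairHalves n ∪ Y, x ≤ c) :
    IsHilbertBasis (rowCone A)
      (Set.range A.row ∪ pairHalfSums A ∪ (fun c => c ᵥ* A) '' Y) := by
  rw [range_row_eq_image, pairHalfSums_eq_image, ← Set.image_union, ← Set.image_union]
  refine isHilbertBasis_image hA.1.2.1
    (((Set.finite_range _).union pairHalves_finite).union hfin) ?_ ?_ ?_ ?_ ?_
  · rintro x ((⟨i, rfl⟩ | ⟨i, j, hij, rfl⟩) | hx)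
    exacts [single_one_mem hA.1.1 i, hA.pair_half_mem hij.ne, hL x hx]
  · rintro x ((⟨i, rfl⟩ | ⟨i, j, hij, rfl⟩) | hx)
    · exact zero_le_single i zero_le_one
    · exact add_nonneg (zero_le_single i (by norm_num)) (zero_le_single j (by norm_num))
    · exact fun i => le_trans (by norm_num) (hquarter x hx i)
  · rintro x ((⟨i, rfl⟩ | ⟨i, j, hij, rfl⟩) | hx)
    · exact exists_quarter_le_single i
    · refine ⟨i, ?_⟩
      simp [hij.ne]; norm_num
    · exact ⟨⟨0, hA.pos⟩, hquarter x hx _⟩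
  · rintro x ((⟨i, rfl⟩ | ⟨i, j, hij, rfl⟩) | hx) y hy h0 h1
    exacts [single_indecomposable hA.1.1 hA.1.2.1 i hy h0 h1,
      hA.pairHalf_indecomposable hij.ne hy h0 h1, hirr x hx y hy h0 h1]
  · intro c hc h0 hne
    rcases single_le_or_lt h0 with ⟨i, hi⟩ | hlt
    · exact ⟨_, Or.inl (Or.inl ⟨i, rfl⟩), hi⟩
    by_cases h2 : ∀ i, 2 * c i ∈ intReals
    · obtain ⟨x, hx, hxc⟩ := hA.exists_pairHalf_le hc h0 hne hlt h2
      exact ⟨x, Or.inl (Or.inr hx), hxc⟩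
    · push Not at h2
      obtain ⟨x, hx | hx, hxc⟩ := hgen c hc h0 hlt h2
      exacts [⟨x, Or.inl (Or.inr hx), hxc⟩, ⟨x, Or.inr hx, hxc⟩]

lemma IsThinTeInterlace.isHilbertBasis [Fintype κ] (hA : IsThinTeInterlace A) :
    IsHilbertBasis (rowCone A) (Set.range A.row ∪ pairHalfSums A) := by
  have := hA.1.isHilbertBasis_union (Y := ∅) Set.finite_empty (by simp) (by simp) (by simp)
    fun c hc _ _ ⟨i, hi⟩ => absurd (hA.two_mul_mem hc i) hi
  simpa using this

/-- Half-integral vectors with an integer entry sum are integer combinations of half sums. -/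
lemma IsTeInterlace.mem_of_half [Fintype κ] (hA : IsTeInterlace A) {c : Fin n → ℝ}
    (h2 : ∀ i, 2 * c i ∈ intReals) (hsum : ∑ i, c i ∈ intReals) : c ∈ coeffLattice A := by
  let o : Fin n := ⟨0, hA.pos⟩
  have h1 : c = (∑ i, (2 * c i) • (Pi.single i (1 / 2) + Pi.single o (1 / 2)) : Fin n → ℝ) -
      (∑ i, c i) • Pi.single o 1 := by
    ext l
    rw [Pi.sub_apply, Finset.sum_apply]
    simp only [Pi.smul_apply, Pi.add_apply, smul_eq_mul, mul_add, Finset.sum_add_distrib,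
      Pi.single_apply, mul_ite, mul_zero, Finset.sum_ite_eq, Finset.mem_univ, if_true]
    split_ifs
    · simp only [← Finset.sum_mul, ← Finset.mul_sum]
      ring
    · simp only [Finset.sum_const_zero]; ring
  rw [h1]
  refine sub_mem (sum_mem fun i _ => smul_mem_coeffLattice (h2 i) ?_)
    (smul_mem_coeffLattice hsum (single_one_mem hA.1.1 o))
  by_cases hi : i = o
  · rw [hi, ← Pi.single_add]
    norm_num
    exact single_one_mem hA.1.1 o
  · exact hA.pair_half_mem hi

end Interlace

section Thick

variable {n : ℕ} {κ : Type*} {A : Matrix (Fin n) κ ℝ}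

lemma two_mul_quarter_notMem : 2 * (1 / 4 : ℝ) ∉ intReals := by
  convert half_notMem_intReals using 2
  norm_num

lemma two_mul_sub_mem {x y : ℝ} (hx4 : 4 * x ∈ intReals) (hy4 : 4 * y ∈ intReals)
    (hx : 2 * x ∉ intReals) (hy : 2 * y ∉ intReals) : 2 * (x - y) ∈ intReals := by
  rw [sub_eq_add_neg]
  refine two_mul_add_mem hx4 ?_ hx ?_
  · rw [mul_neg]; exact intReals.neg_mem hy4
  · rw [mul_neg, neg_mem_iff]; exact hy

lemma four_mul_quarter_mem : 4 * (1 / 4 : ℝ) ∈ intReals := by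
  norm_num

/-- Either the vector with all entries `1/4` or all vectors with one entry `3/4` and the others
`1/4` occur: they differ from a vector outside `(ℤ/2)ⁿ` by a half-integral one. -/
lemma IsThickTeInterlace.quarter_mem_or [Fintype κ] (hA : IsThickTeInterlace A) :
    (fun _ => 1 / 4) ∈ coeffLattice A ∨ ∀ x ∈ threeQuarters n, x ∈ coeffLattice A := by
  obtain ⟨q, hq, i₀, hi₀⟩ := hA.exists_not_half
  have hodd : ∀ i, 2 * q i ∉ intReals := (hA.forall_half_or hq).resolve_left fun h => hi₀ (h i₀)
  set h : Fin n → ℝ := (fun _ => 1 / 4) - q with hh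
  have h2 : ∀ i, 2 * h i ∈ intReals := fun i =>
    two_mul_sub_mem four_mul_quarter_mem (hA.four_mul_mem hq i) two_mul_quarter_notMem (hodd i)
  have hsum : 2 * ∑ i, h i ∈ intReals := by
    rw [Finset.mul_sum]; exact intReals.sum_mem fun i _ => h2 i
  rcases mem_intReals_or_of_two_mul hsum with hs | hs
  · left
    have : (fun _ => 1 / 4 : Fin n → ℝ) = q + h := by rw [hh]; simp
    rw [this]
    exact add_mem hq (hA.1.mem_of_half h2 hs)
  · right
    rintro _ ⟨i, rfl⟩
    have : (Pi.single i (1 / 2) + fun _ => 1 / 4 : Fin n → ℝ) =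
        q + (h + Pi.single i (1 / 2)) := by rw [hh]; abel
    change (Pi.single i (1 / 2) + fun _ => 1 / 4 : Fin n → ℝ) ∈ _
    rw [this]
    refine add_mem hq (hA.1.mem_of_half (fun j => ?_) ?_)
    · rw [Pi.add_apply, mul_add]
      refine intReals.add_mem (h2 j) ?_
      rw [Pi.single_apply]
      split_ifs <;> simp
    · simp only [Pi.add_apply, Finset.sum_add_distrib, Finset.sum_pi_single', Finset.mem_univ,
        if_true]
      convert intReals.add_mem hs intReals.one_mem using 1
      ring

lemma IsTeInterlace.not_quarter_mem_of_threeQuarters (hA : IsTeInterlace A)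
    (h : ∀ x ∈ threeQuarters n, x ∈ coeffLattice A) : (fun _ => 1 / 4) ∉ coeffLattice A := by
  intro hq
  let o : Fin n := ⟨0, hA.pos⟩
  have h1 := sub_mem (h _ ⟨o, rfl⟩) hq
  rw [add_sub_cancel_right] at h1
  have h2 := hA.apply_mem_of_support h1 (i := o) fun j hj => by simp [hj]
  rw [Pi.single_eq_same] at h2
  exact half_notMem_intReals h2

lemma quarter_or_of_lt_one {x : ℝ} (h4 : 4 * x ∈ intReals) (h2 : 2 * x ∉ intReals) (h0 : 0 ≤ x)
    (h1 : x < 1) : x = 1 / 4 ∨ x = 3 / 4 := by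
  have h := (mem_intReals_or_of_two_mul (by convert h4 using 1; ring : 2 * (2 * x) ∈ intReals)
    ).resolve_left h2
  obtain ⟨z, hz⟩ := mem_intReals.1 h
  have hz0 : -1 < z := by exact_mod_cast (by linarith : (-1 : ℝ) < z)
  have hz1 : z < 2 := by exact_mod_cast (by linarith : (z : ℝ) < 2)
  have : z = 0 ∨ z = 1 := by omega
  rcases this with rfl | rfl
  · left; push_cast at hz; linarith
  · right; push_cast at hz; linarith

/-- Below `1`, a coefficient vector outside `(ℤ/2)ⁿ` has entries `1/4` and `3/4`; two entries `3/4`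
allow the subtraction of a half sum. -/
lemma IsThickTeInterlace.pairHalf_le_or [Fintype κ] (hA : IsThickTeInterlace A) {c : Fin n → ℝ}
    (hc : c ∈ coeffLattice A) (h0 : 0 ≤ c) (hlt : ∀ i, c i < 1) (hne : ∃ i, 2 * c i ∉ intReals) :
    (∃ x ∈ pairHalves n, x ≤ c) ∨ c = (fun _ => 1 / 4) ∨ c ∈ threeQuarters n := by
  obtain ⟨i₀, hi₀⟩ := hne
  have hodd : ∀ i, 2 * c i ∉ intReals := (hA.forall_half_or hc).resolve_left fun h => hi₀ (h i₀)
  have hor : ∀ i, c i = 1 / 4 ∨ c i = 3 / 4 := fun i =>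
    quarter_or_of_lt_one (hA.four_mul_mem hc i) (hodd i) (h0 i) (hlt i)
  by_cases hex : ∃ i, c i = 3 / 4
  · obtain ⟨i, hi⟩ := hex
    by_cases hex2 : ∃ j, j ≠ i ∧ c j = 3 / 4
    · obtain ⟨j, hji, hj⟩ := hex2
      exact Or.inl (pairHalf_le h0 hji (by rw [hj]; norm_num) (by rw [hi]; norm_num))
    · right; right
      push Not at hex2
      refine ⟨i, funext fun j => ?_⟩
      by_cases hj : j = i
      · subst hj; simp [hi]; norm_num
      · simp [hj, (hor j).resolve_right (hex2 j hj)]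
  · right; left
    push Not at hex
    exact funext fun i => (hor i).resolve_right (hex i)

lemma IsTeInterlace.eq_zero_of_le_quarter (hA : IsTeInterlace A) {y : Fin n → ℝ}
    (hy : y ∈ coeffLattice A) (h0 : 0 ≤ y) (i : Fin n) (hle : ∀ j, j ≠ i → y j ≤ 1 / 4)
    (hi : y i < 1) (h2 : ∀ j, 2 * y j ∈ intReals) : y = 0 := by
  have hsupp : ∀ j, j ≠ i → y j = 0 := fun j hj => by
    have := eq_zero_of_mem_intReals_of_lt_one (h2 j) (mul_nonneg (by norm_num) (h0 j))
      (by linarith [hle j hj])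
    linarith
  have := eq_zero_of_mem_intReals_of_lt_one (hA.apply_mem_of_support hy hsupp) (h0 i) hi
  ext j
  by_cases hj : j = i
  · rw [hj]; exact this
  · exact hsupp j hj

end Thick

/-! ### Thick te-interlaces: the two cases -/

section Thick

variable {n : ℕ} {κ : Type*} {A : Matrix (Fin n) κ ℝ}

lemma const_le_threeQuarters (x : Fin n → ℝ) (hx : x ∈ threeQuarters n) (i : Fin n) :
    1 / 4 ≤ x i := by
  obtain ⟨l, rfl⟩ := hx
  have := zero_le_single l (n := n) (t := 1 / 2) (by norm_num) i
  simpa using this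

lemma IsThickTeInterlace.isHilbertBasis_quarter [Fintype κ] (hA : IsThickTeInterlace A)
    (hq : (fun _ => 1 / 4) ∈ coeffLattice A) :
    IsHilbertBasis (rowCone A)
      (Set.range A.row ∪ pairHalfSums A ∪ {(1 / 4 : ℝ) • ∑ j, A.row j}) := by
  rw [smul_sum_row_eq, ← Set.image_singleton (f := fun c => c ᵥ* A)]
  refine hA.1.isHilbertBasis_union (Set.finite_singleton _) ?_ ?_ ?_ ?_
  · rintro _ rfl; exact hq
  · rintro _ rfl i; exact le_rfl
  · rintro _ rfl y hy h0 h1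
    by_cases h2 : ∀ i, 2 * y i ∈ intReals
    · left
      exact hA.1.eq_zero_of_le_quarter hy h0 ⟨0, hA.1.pos⟩ (fun j _ => h1 j)
        ((h1 _).trans_lt (by norm_num)) h2
    · right
      have hodd := (hA.forall_half_or hy).resolve_left h2
      ext i
      have hle : y i ≤ 1 / 4 := h1 i
      refine (quarter_or_of_lt_one (hA.four_mul_mem hy i) (hodd i) (h0 i) (by linarith)
        ).resolve_right fun h => ?_
      linarith
  · intro c hc h0 hlt hne
    rcases hA.pairHalf_le_or hc h0 hlt hne with ⟨x, hx, hxc⟩ | h | h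
    · exact ⟨x, Or.inl hx, hxc⟩
    · exact ⟨_, Or.inr rfl, h.ge⟩
    · exact ⟨_, Or.inr rfl, const_le_threeQuarters c h⟩

lemma IsThickTeInterlace.isHilbertBasis_threeQuarters [Fintype κ] (hA : IsThickTeInterlace A)
    (hq : ∀ x ∈ threeQuarters n, x ∈ coeffLattice A) :
    IsHilbertBasis (rowCone A)
      (Set.range A.row ∪ pairHalfSums A ∪ threeQuarterSums A) := by
  rw [threeQuarterSums_eq_image]
  refine hA.1.isHilbertBasis_union (Set.finite_range _) hq const_le_threeQuarters ?_ ?_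
  · rintro _ ⟨i, rfl⟩ y hy h0 h1
    set x : Fin n → ℝ := Pi.single i (1 / 2) + fun _ => 1 / 4 with hxdef
    have hx : x ∈ coeffLattice A := hq _ ⟨i, rfl⟩
    have hxi : x i = 3 / 4 := by simp [hxdef]; norm_num
    have hxj : ∀ j, j ≠ i → x j = 1 / 4 := fun j hj => by simp [hxdef, hj]
    have hxodd : ∀ j, 2 * x j ∉ intReals := by
      refine (hA.forall_half_or hx).resolve_left fun h => ?_
      have := mem_intReals_or_of_two_mul (h i)
      rw [hxi] at this
      rcases this with h | h
      · have := eq_zero_of_mem_intReals_of_lt_one h (by norm_num) (by norm_num)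
        norm_num at this
      · have := eq_zero_of_mem_intReals_of_lt_one h (by norm_num) (by norm_num)
        norm_num at this
    have hzero : ∀ z ∈ coeffLattice A, 0 ≤ z → z ≤ x → (∀ j, 2 * z j ∈ intReals) → z = 0 :=
      fun z hz hz0 hz1 => hA.1.eq_zero_of_le_quarter hz hz0 i
        (fun j hj => (hz1 j).trans (hxj j hj).le) ((hz1 i).trans_lt (by rw [hxi]; norm_num))
    rcases hA.forall_half_or hy with h | h
    · exact Or.inl (hzero y hy h0 h1 h)
    -- Otherwise the complementary summand `x - y` is half-integral.
    · right
      have h2 := hzero (x - y) (sub_mem hx hy) (sub_nonneg.2 h1) (sub_le_self _ h0) fun j =>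
        two_mul_sub_mem (hA.four_mul_mem hx j) (hA.four_mul_mem hy j) (hxodd j) (h j)
      exact (sub_eq_zero.1 h2).symm
  · intro c hc h0 hlt hne
    rcases hA.pairHalf_le_or hc h0 hlt hne with ⟨x, hx, hxc⟩ | h | h
    · exact ⟨x, Or.inl hx, hxc⟩
    · exact absurd (h ▸ hc) (hA.1.not_quarter_mem_of_threeQuarters hq)
    · exact ⟨c, Or.inr h, le_rfl⟩

/-- A Hilbert basis consists of integer points. -/
lemma IsHilbertBasis.mem_coeffLattice {H : Set (κ → ℝ)} (hH : IsHilbertBasis (rowCone A) H)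
    {c : Fin n → ℝ} (hc : c ᵥ* A ∈ H) : c ∈ coeffLattice A := fun k =>
  mem_intReals.2 ((hH.2.1 _ hc).1.2 k)

lemma IsThickTeInterlace.isHilbertBasis_quarter_iff [Fintype κ] (hA : IsThickTeInterlace A) :
    IsHilbertBasis (rowCone A)
      (Set.range A.row ∪ pairHalfSums A ∪ {(1 / 4 : ℝ) • ∑ j, A.row j}) ↔
      (fun _ => 1 / 4) ∈ coeffLattice A :=
  ⟨fun h => h.mem_coeffLattice (Or.inr (smul_sum_row_eq _).symm), hA.isHilbertBasis_quarter⟩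

lemma IsThickTeInterlace.isHilbertBasis_threeQuarters_iff [Fintype κ] (hA : IsThickTeInterlace A) :
    IsHilbertBasis (rowCone A)
      (Set.range A.row ∪ pairHalfSums A ∪ threeQuarterSums A) ↔
      ∀ x ∈ threeQuarters n, x ∈ coeffLattice A :=
  ⟨fun h x hx => h.mem_coeffLattice (Or.inr (by
    rw [threeQuarterSums_eq_image]; exact ⟨x, hx, rfl⟩)), hA.isHilbertBasis_threeQuarters⟩

lemma IsTeInterlace.ncard_add_ncard [Fintype κ] (hA : IsTeInterlace A) {i : Fin n} {k : κ}
    (hi : A i k ≠ 0) :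
    Set.ncard {i | A i k = 1} + Set.ncard {i | A i k = -1} = n := by
  classical
  rw [← Set.ncard_union_eq]
  · have : {i | A i k = 1} ∪ {i | A i k = -1} = Set.univ :=
      Set.eq_univ_of_forall fun j => hA.apply_eq hi j
    rw [this, Set.ncard_univ, Nat.card_fin]
  · rw [Set.disjoint_left]
    intro j (h1 : A j k = 1) (h2 : A j k = -1)
    rw [h1] at h2; norm_num at h2

lemma IsZeroPmOne.sum_col (hA : IsZeroPmOne A) (k : κ) :
    ∑ i, A i k = (Set.ncard {i | A i k = 1} : ℝ) - Set.ncard {i | A i k = -1} := by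
  classical
  rw [Set.ncard_eq_toFinset_card', Set.ncard_eq_toFinset_card', Set.toFinset_ofPred,
    Set.toFinset_ofPred, ← Finset.sum_boole, ← Finset.sum_boole, ← Finset.sum_sub_distrib]
  refine Finset.sum_congr rfl fun i _ => ?_
  rcases hA i k with h | h | h <;> rw [h] <;> norm_num

/-- For a nonzero column with `P` entries `1` and `N` entries `-1`, one has `P + N = n` and either
`P - N ≡ 0` or `P - N ≡ 2` modulo `4`, according to which of the two kinds of quarter vectors
occurs. -/
lemma IsThickTeInterlace.exists_parity [Fintype κ] (hA : IsThickTeInterlace A) :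
    ∃ p : ℕ, (p = 0 ∨ p = 1) ∧
      (∀ k, (∃ i, A i k ≠ 0) →
        Set.ncard {i | A i k = 1} ≡ p [MOD 2] ∧ Set.ncard {i | A i k = -1} ≡ p [MOD 2]) ∧
      ((fun _ => 1 / 4) ∈ coeffLattice A ↔ n ≡ 2 * p [MOD 4]) := by
  have hconst : ∀ k, ((fun _ => 1 / 4) ᵥ* A) k =
      1 / 4 * ((Set.ncard {i | A i k = 1} : ℝ) - Set.ncard {i | A i k = -1}) := fun k => by
    rw [← hA.1.1.1.sum_col, Finset.mul_sum]; rfl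
  let o : Fin n := ⟨0, hA.1.pos⟩
  rcases hA.quarter_mem_or with hq | hq
  · have key : ∀ k, (∃ i, A i k ≠ 0) → ∃ z : ℤ,
        (Set.ncard {i | A i k = 1} : ℤ) - Set.ncard {i | A i k = -1} = 4 * z ∧
        Set.ncard {i | A i k = 1} + Set.ncard {i | A i k = -1} = n := by
      rintro k ⟨i, hi⟩
      obtain ⟨z, hz⟩ := mem_intReals.1 (hq k)
      rw [hconst] at hz
      refine ⟨z, ?_, hA.1.ncard_add_ncard hi⟩
      have : (Set.ncard {i | A i k = 1} : ℝ) - Set.ncard {i | A i k = -1} = 4 * z := by linarith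
      exact_mod_cast this
    refine ⟨n / 2 % 2, by omega, fun k hk => ?_, ?_⟩
    · obtain ⟨z, h1, h2⟩ := key k hk
      simp only [Nat.ModEq]
      omega
    · obtain ⟨k, hk⟩ := hA.1.exists_ne_zero o
      obtain ⟨z, h1, h2⟩ := key k ⟨o, hk⟩
      simp only [hq, true_iff, Nat.ModEq]
      omega
  · have key : ∀ k, (∃ i, A i k ≠ 0) → ∃ z : ℤ,
        (Set.ncard {i | A i k = 1} : ℤ) - Set.ncard {i | A i k = -1} = 4 * z + 2 ∧
        Set.ncard {i | A i k = 1} + Set.ncard {i | A i k = -1} = n := by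
      rintro k ⟨i, hi⟩
      obtain ⟨z, hz⟩ := mem_intReals.1 (hq _ ⟨i, rfl⟩ k)
      rw [add_vecMul, single_vecMul, Pi.add_apply, hconst, Pi.smul_apply, row_apply,
        smul_eq_mul] at hz
      rcases hA.1.apply_eq hi i with h | h
      · refine ⟨z - 1, ?_, hA.1.ncard_add_ncard hi⟩
        rw [h] at hz
        have : (Set.ncard {i | A i k = 1} : ℝ) - Set.ncard {i | A i k = -1} =
          4 * ((z - 1 : ℤ) : ℝ) + 2 := by push_cast; linarith
        exact_mod_cast this
      · refine ⟨z, ?_, hA.1.ncard_add_ncard hi⟩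
        rw [h] at hz
        have : (Set.ncard {i | A i k = 1} : ℝ) - Set.ncard {i | A i k = -1} =
          4 * (z : ℝ) + 2 := by linarith
        exact_mod_cast this
    refine ⟨(n / 2 + 1) % 2, by omega, fun k hk => ?_, ?_⟩
    · obtain ⟨z, h1, h2⟩ := key k hk
      simp only [Nat.ModEq]
      omega
    · obtain ⟨k, hk⟩ := hA.1.exists_ne_zero o
      obtain ⟨z, h1, h2⟩ := key k ⟨o, hk⟩
      simp only [hA.1.not_quarter_mem_of_threeQuarters hq, false_iff, Nat.ModEq]
      omega

end Thick

theorem theorem4p2 (n d : ℕ) (A : Matrix (Fin n) (Fin d) ℝ) (hA : IsTeBrick A) :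
    (IsTuSet A → IsHilbertBasis (rowCone A) (Set.range A.row)) ∧
    (IsTeLace A →
      IsHilbertBasis (rowCone A) (Set.range A.row ∪ {(1 / 2 : ℝ) • ∑ j, A.row j})) ∧
    (IsThinTeInterlace A →
      IsHilbertBasis (rowCone A) (Set.range A.row ∪ pairHalfSums A)) ∧
    (IsThickTeInterlace A →
      Xor
        (IsHilbertBasis (rowCone A)
          (Set.range A.row ∪ pairHalfSums A ∪ {(1 / 4 : ℝ) • ∑ j, A.row j}))
        (IsHilbertBasis (rowCone A)
          (Set.range A.row ∪ pairHalfSums A ∪ threeQuarterSums A)) ∧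
      ∃ p : ℕ, (p = 0 ∨ p = 1) ∧
        (∀ k : Fin d, (∃ i, A i k ≠ 0) →
          Set.ncard {i | A i k = 1} ≡ p [MOD 2] ∧ Set.ncard {i | A i k = -1} ≡ p [MOD 2]) ∧
        (IsHilbertBasis (rowCone A)
            (Set.range A.row ∪ pairHalfSums A ∪ {(1 / 4 : ℝ) • ∑ j, A.row j}) ↔
          n ≡ 2 * p [MOD 4])) := by
  refine ⟨IsTuSet.isHilbertBasis, IsTeLace.isHilbertBasis, IsThinTeInterlace.isHilbertBasis,
    fun h => ?_⟩
  rw [h.isHilbertBasis_quarter_iff, h.isHilbertBasis_threeQuarters_iff]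
  refine ⟨?_, h.exists_parity⟩
  by_cases hq : (fun _ => 1 / 4) ∈ coeffLattice A
  · exact Or.inl ⟨hq, fun h' => h.1.not_quarter_mem_of_threeQuarters h' hq⟩
  · exact Or.inr ⟨h.quarter_mem_or.resolve_left hq, hq⟩
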